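/- **Setting.** For $N\ge 0$ let $\mathbb Q[x_1,\dots,x_N;\theta_1,\dots,\theta_N]$ be the ring of polynomials in commuting variables $x_i$ and anticommuting variables $\theta_i$ ($\theta_i\theta_j=-\theta_j\theta_i$, $\theta_i^2=0$, $x_i\theta_j=\theta_jx_i$), with the diagonal action of $S_N$. Let $\mathbf\Lambda^{n,m}$ be the space of symmetric functions in superspace of total degree $n$ and fermionic degree $m$: families $(f_N)_{N\ge0}$ of $S_N$-invariant superpolynomials $f_N$, homogeneous of degree $n$ in the $x$'s and $m$ in the $\theta$'s, with $f_N=f_{N+1}|_{x_{N+1}=\theta_{N+1}=0}$. Let $\mathbf\Lambda=\bigoplus_{n,m}\mathbf\Lambda^{n,m}$ be the ring of symmetric functions in superspace, and $\mathbf\Lambda^k=\bigoplus_{n+m=k}\mathbf\Lambda^{n,m}$. All signs are governed by the fermionic degree, written $\deg$; thus $\mathbf\Lambda\otimes\mathbf\Lambda$ carries the product $(f_1\otimes g_1)(f_2\otimes g_2)=(-1)^{\deg g_1\deg f_2}f_1f_2\otimes g_1g_2$ and the twist $\tau(g\otimes h)=(-1)^{\deg g\deg h}h\otimes g$. For a bilinear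 form $\langle\cdot,\cdot\rangle$ on $\mathbf\Lambda$ the *signed extension* to $\mathbf\Lambda\otimes\mathbf\Lambda$ is $\langle f_1\otimes g_1,f_2\otimes g_2\rangle=(-1)^{\deg g_1\deg f_2}\langle f_1,f_2\rangle\langle g_1,g_2\rangle$, and the *plain extension* is the same without the sign. A superpartition $\Lambda=(\Lambda^a;\Lambda^s)$ consists of a strictly decreasing sequence $\Lambda^a=(\Lambda_1>\dots>\Lambda_m\ge0)$ and a partition $\Lambda^s=(\Lambda_{m+1}\ge\dots\ge\Lambda_\ell\ge 1)$. Put $p_\Lambda=\tilde p_{\Lambda_1}\cdots\tilde p_{\Lambda_m}p_{\Lambda_{m+1}}\cdots p_{\Lambda_\ell}$, where $p_r=\sum_i x_i^r$ and $\tilde p_k=\sum_i\theta_ix_i^k$, and $z_{\Lambda^s}=\prod_i i^{n_i}n_i!$, where $n_i$ is the number of parts of $\Lambda^s$ equal to $i$. **Proposition.** The $p_\Lambda$ form a basis of $\mathbf\Lambda$. The map $f\otimes g\mapsto f(x;\theta)g(y;\phi)$ (the $\theta$'s and $\phi$'s anticommuting) is injective on $\mathbf\Lambda\otimes\mathbf\Lambda$.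 With the coproduct $\Delta f=f(x,y;\theta,\phi)$, which lies in its image, and the counit $\epsilon$ that is the projection on $\mathbf\Lambda^0=\mathbb Q$, the ring $\mathbf\Lambda$ is a Hopf algebra in the topologist's sense: $\Delta$ is coassociative and counital, $\Delta$ and $\epsilon$ are algebra morphisms (for the signed product on $\mathbf\Lambda\otimes\mathbf\Lambda$), there is an antipode $S$, and $\Delta,\epsilon,S$ preserve the fermionic degree. It is graded and connected for $\mathbf\Lambda=\bigoplus_k\mathbf\Lambda^k$. Moreover: 1. It is cocommutative: $\tau\circ\Delta=\Delta$. 2. It is self-dual in the topologist's sense: the bilinear form with $\langle p_\Lambda,p_\Omega\rangle=\delta_{\Lambda\Omega}(-1)^{\binom m2}z_{\Lambda^s}$ ($m$ the fermionic degree of $\Lambda$) is non-degenerate and, with its signed extension, satisfies for all $f,g,a,b\in\mathbf\Lambda$ $$\langle fg,a\rangle=\langle f\otimes g,\Delta a\rangle,\quad \langle f,ab\rangle=\langle\Delta f,a\otimes b\rangle,\quad \langle1,a\rangle=\epsilon(a),\quad \langle f,1\rangle=\epsilon(f),\quad \langle Sf,a\rangle=\langle f,Sa\rangle .$$ 3.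 The form with $\langle\!\langle p_\Lambda,p_\Omega\rangle\!\rangle=\delta_{\Lambda\Omega}z_{\Lambda^s}$ (the extended Hall scalar product) is non-degenerate and satisfies the same five identities with its plain extension; with its signed extension it satisfies $\langle\!\langle\Delta f,g\otimes h\rangle\!\rangle=\langle\!\langle f,hg\rangle\!\rangle$ for all $f,g,h\in\mathbf\Lambda$. -/

import Mathlib

open scoped TensorProduct

noncomputable section

/-! ### Superspace polynomials -/

/-- The polynomial ring `ℚ[x_i ; θ_i]`, `i ∈ I`, in commuting variables `x_i` and anticommuting
variables `θ_i` (with `θ_i ^ 2 = 0`, the `x`'s commuting with the `θ`'s). -/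
abbrev SuperPoly (I : Type) : Type :=
  MvPolynomial I ℚ ⊗[ℚ] ExteriorAlgebra ℚ (I →₀ ℚ)

namespace SuperPoly

/-- The commuting variable `x_i`. -/
def x {I : Type} (i : I) : SuperPoly I := MvPolynomial.X i ⊗ₜ[ℚ] 1

/-- The anticommuting variable `θ_i`. -/
def θ {I : Type} (i : I) : SuperPoly I :=
  1 ⊗ₜ[ℚ] ExteriorAlgebra.ι ℚ (Finsupp.single i (1 : ℚ))

/-- The algebra morphism replacing `(x_i, θ_i)` by `(x_j, θ_j)` if `g i = some j`,
and by `(0, 0)` if `g i = none`. -/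
def subst {I J : Type} (g : I → Option J) : SuperPoly I →ₐ[ℚ] SuperPoly J :=
  Algebra.TensorProduct.map
    (MvPolynomial.aeval fun i => (g i).elim (0 : MvPolynomial J ℚ) MvPolynomial.X)
    (ExteriorAlgebra.map
      (Finsupp.linearCombination ℚ fun i => (g i).elim (0 : J →₀ ℚ) fun j => Finsupp.single j 1))

/-- The superpolynomials that are homogeneous of degree `n` in the `x`'s (the total degree)
and of degree `m` in the `θ`'s (the fermionic degree). -/
def bihomogeneous (I : Type) (n m : ℕ) : Submodule ℚ (SuperPoly I) :=
  Submodule.map₂ (TensorProduct.mk ℚ (MvPolynomial I ℚ) (ExteriorAlgebra ℚ (I →₀ ℚ)))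
    (MvPolynomial.homogeneousSubmodule I ℚ n) (⋀[ℚ]^m (I →₀ ℚ))

theorem subst_x {I J : Type} (g : I → Option J) (i : I) :
    subst g (x i) = (g i).elim 0 x := by
  cases h : g i <;> simp [subst, x, h]

theorem subst_θ {I J : Type} (g : I → Option J) (i : I) :
    subst g (θ i) = (g i).elim 0 θ := by
  cases h : g i <;> simp [subst, θ, h]

theorem θ_mul_θ {I : Type} (i j : I) : θ i * θ j = -(θ j * θ i) := by
  have h := ExteriorAlgebra.ι_add_mul_swap (R := ℚ) (Finsupp.single i (1 : ℚ))
    (Finsupp.single j (1 : ℚ))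
  rw [eq_neg_iff_add_eq_zero]
  simp only [θ, Algebra.TensorProduct.tmul_mul_tmul, one_mul]
  rw [← TensorProduct.tmul_add, h, TensorProduct.tmul_zero]

theorem x_mul_θ {I : Type} (i j : I) : x i * θ j = θ j * x i := by
  simp [x, θ]

theorem x_mul_x {I : Type} (i j : I) : x i * x j = x j * x i := by
  simp [x, mul_comm]

theorem one_mem_bihomogeneous (I : Type) : (1 : SuperPoly I) ∈ bihomogeneous I 0 0 :=
  Submodule.apply_mem_map₂ _ (MvPolynomial.isHomogeneous_one I ℚ)
    (SetLike.GradedOne.one_mem (A := fun i : ℕ => ⋀[ℚ]^i (I →₀ ℚ)))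

theorem mul_mem_bihomogeneous {I : Type} {n m n' m' : ℕ} {a b : SuperPoly I}
    (ha : a ∈ bihomogeneous I n m) (hb : b ∈ bihomogeneous I n' m') :
    a * b ∈ bihomogeneous I (n + n') (m + m') := by
  have h : bihomogeneous I n m ≤
      (bihomogeneous I (n + n') (m + m')).comap (LinearMap.mulRight ℚ b) := by
    refine Submodule.map₂_le.2 fun p hp w hw => ?_
    have h' : bihomogeneous I n' m' ≤
        (bihomogeneous I (n + n') (m + m')).comap (LinearMap.mulLeft ℚ (p ⊗ₜ[ℚ] w)) := by
      refine Submodule.map₂_le.2 fun q hq v hv => ?_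
      have hm : w * v ∈ ⋀[ℚ]^(m + m') (I →₀ ℚ) :=
        SetLike.GradedMul.mul_mem (A := fun i : ℕ => ⋀[ℚ]^i (I →₀ ℚ)) hw hv
      have hp' : p * q ∈ MvPolynomial.homogeneousSubmodule I ℚ (n + n') :=
        MvPolynomial.IsHomogeneous.mul hp hq
      have := Submodule.apply_mem_map₂
        (TensorProduct.mk ℚ (MvPolynomial I ℚ) (ExteriorAlgebra ℚ (I →₀ ℚ))) hp' hm
      rw [Submodule.mem_comap, LinearMap.mulLeft_apply, TensorProduct.mk_apply,
        Algebra.TensorProduct.tmul_mul_tmul]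
      exact this
    exact h' hb
  exact h ha

theorem x_mem_bihomogeneous {I : Type} (i : I) : x i ∈ bihomogeneous I 1 0 :=
  Submodule.apply_mem_map₂ _ (MvPolynomial.isHomogeneous_X ℚ i)
    (SetLike.GradedOne.one_mem (A := fun i : ℕ => ⋀[ℚ]^i (I →₀ ℚ)))

theorem θ_mem_bihomogeneous {I : Type} (i : I) : θ i ∈ bihomogeneous I 0 1 :=
  Submodule.apply_mem_map₂ _ (MvPolynomial.isHomogeneous_one I ℚ)
    (show ExteriorAlgebra.ι ℚ (Finsupp.single i (1 : ℚ)) ∈ ⋀[ℚ]^1 (I →₀ ℚ) by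
      rw [show ⋀[ℚ]^1 (I →₀ ℚ) = LinearMap.range (ExteriorAlgebra.ι ℚ) from pow_one _]
      exact LinearMap.mem_range_self _ _)

theorem x_pow_mem_bihomogeneous {I : Type} (i : I) (k : ℕ) :
    x i ^ k ∈ bihomogeneous I k 0 := by
  induction k with
  | zero => simpa using one_mem_bihomogeneous I
  | succ k ih => 
    have h := mul_mem_bihomogeneous ih (x_mem_bihomogeneous i)
    rwa [← pow_succ] at h

/-- The projection onto the part of fermionic degree `m`. -/
def fermionicPart (I : Type) (m : ℕ) : SuperPoly I →ₗ[ℚ] SuperPoly I :=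
  LinearMap.lTensor _ (GradedAlgebra.proj (fun i : ℕ => ⋀[ℚ]^i (I →₀ ℚ)) m)

theorem fermionicPart_of_mem {I : Type} {n m : ℕ} {a : SuperPoly I}
    (ha : a ∈ bihomogeneous I n m) : fermionicPart I m a = a := by
  have h : bihomogeneous I n m ≤ LinearMap.eqLocus (fermionicPart I m) LinearMap.id := by
    refine Submodule.map₂_le.2 fun p _ w hw => ?_
    simp [LinearMap.mem_eqLocus, fermionicPart, GradedAlgebra.proj_apply,
      DirectSum.decompose_of_mem_same (fun i : ℕ => ⋀[ℚ]^i (I →₀ ℚ)) hw]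
  exact h ha

theorem fermionicPart_of_mem_ne {I : Type} {n m k : ℕ} (hk : m ≠ k) {a : SuperPoly I}
    (ha : a ∈ bihomogeneous I n m) : fermionicPart I k a = 0 := by
  have h : bihomogeneous I n m ≤ LinearMap.ker (fermionicPart I k) := by
    refine Submodule.map₂_le.2 fun p _ w hw => ?_
    simp [LinearMap.mem_ker, fermionicPart, GradedAlgebra.proj_apply,
      DirectSum.decompose_of_mem_ne (fun i : ℕ => ⋀[ℚ]^i (I →₀ ℚ)) hw hk]
  exact h ha

end SuperPoly

/-! ### The ring of symmetric functions in superspace -/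

open SuperPoly

/-- Families `f_N(x_1, …, x_N; θ_1, …, θ_N)`, one superpolynomial for each number `N` of
variables. -/
abbrev SuperFamily : Type := (N : ℕ) → SuperPoly (Fin N)

/-- Dropping the last variable. -/
def dropLast (N : ℕ) : Fin (N + 1) → Option (Fin N) :=
  Fin.lastCases none some

/-- The bihomogeneous symmetric functions in superspace of total degree `n` and fermionic degree
`m`, as an inverse limit: families `(f_N)` where `f_N` is bihomogeneous of degree `(n|m)`, is
invariant under the diagonal action of the symmetric group on the `x`'s and the `θ`'s, and
is obtained from `f_{N+1}` by setting `x_{N+1} = θ_{N+1} = 0`. -/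
def symFamily (n m : ℕ) : Submodule ℚ SuperFamily where
  carrier := {f | (∀ N, f N ∈ bihomogeneous (Fin N) n m) ∧
    (∀ N (σ : Equiv.Perm (Fin N)), subst (fun i => some (σ i)) (f N) = f N) ∧
    (∀ N, subst (dropLast N) (f (N + 1)) = f N)}
  zero_mem' := by simp
  add_mem' := by
    rintro f g ⟨h1, h2, h3⟩ ⟨k1, k2, k3⟩
    exact ⟨fun N => add_mem (h1 N) (k1 N), fun N σ => by simp [h2 N σ, k2 N σ],
      fun N => by simp [h3 N, k3 N]⟩
  smul_mem' := by
    rintro c f ⟨h1, h2, h3⟩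
    exact ⟨fun N => Submodule.smul_mem _ c (h1 N), fun N σ => by simp [h2 N σ],
      fun N => by simp [h3 N]⟩

theorem one_mem_symFamily : (1 : SuperFamily) ∈ symFamily 0 0 :=
  ⟨fun N => one_mem_bihomogeneous (Fin N), fun N σ => by simp, fun N => by simp⟩

theorem mul_mem_symFamily {n m n' m' : ℕ} {f g : SuperFamily}
    (hf : f ∈ symFamily n m) (hg : g ∈ symFamily n' m') :
    f * g ∈ symFamily (n + n') (m + m') :=
  ⟨fun N => mul_mem_bihomogeneous (hf.1 N) (hg.1 N),
    fun N σ => by simp [hf.2.1 N σ, hg.2.1 N σ],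
    fun N => by simp [hf.2.2 N, hg.2.2 N]⟩

/-- The ring of symmetric functions in superspace, `⨁_{n,m} Λ^{n,m}`, as a subalgebra of the
algebra of families. -/
def superSymSubalgebra : Subalgebra ℚ SuperFamily where
  carrier := {f | f ∈ ⨆ p : ℕ × ℕ, symFamily p.1 p.2}
  zero_mem' := Submodule.zero_mem (⨆ p : ℕ × ℕ, symFamily p.1 p.2)
  one_mem' := (le_iSup (fun p : ℕ × ℕ => symFamily p.1 p.2) (0, 0)) one_mem_symFamily
  add_mem' := fun ha hb => Submodule.add_mem (⨆ p : ℕ × ℕ, symFamily p.1 p.2) ha hb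
  algebraMap_mem' := fun r => by
    rw [Algebra.algebraMap_eq_smul_one]
    exact Submodule.smul_mem _ r
      ((le_iSup (fun p : ℕ × ℕ => symFamily p.1 p.2) (0, 0)) one_mem_symFamily)
  mul_mem' := by
    intro a b ha hb
    have h : (⨆ p : ℕ × ℕ, symFamily p.1 p.2) ≤
        (⨆ p : ℕ × ℕ, symFamily p.1 p.2).comap (LinearMap.mulRight ℚ b) := by
      refine iSup_le fun p f hf => ?_
      have h' : (⨆ p : ℕ × ℕ, symFamily p.1 p.2) ≤
          (⨆ p : ℕ × ℕ, symFamily p.1 p.2).comap (LinearMap.mulLeft ℚ f) := by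
        refine iSup_le fun q g hg => ?_
        exact (le_iSup (fun p : ℕ × ℕ => symFamily p.1 p.2) (p.1 + q.1, p.2 + q.2))
          (mul_mem_symFamily hf hg)
      exact h' hb
    exact h ha

theorem mem_superSymSubalgebra {f : SuperFamily} :
    f ∈ superSymSubalgebra ↔ f ∈ ⨆ p : ℕ × ℕ, symFamily p.1 p.2 := Iff.rfl

/-- The ring of symmetric functions in superspace. -/
def SuperSym : Type := superSymSubalgebra

namespace SuperSym

instance : Ring SuperSym := inferInstanceAs (Ring superSymSubalgebra)

instance : Algebra ℚ SuperSym := inferInstanceAs (Algebra ℚ superSymSubalgebra)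

/-- The inclusion of `SuperSym` in the algebra of families: the `N`-th component of `toFamily f` is
`f(x_1, …, x_N; θ_1, …, θ_N)`. -/
def toFamily : SuperSym →ₐ[ℚ] SuperFamily := superSymSubalgebra.val

theorem toFamily_injective : Function.Injective toFamily := Subtype.val_injective

/-- The component `Λ^{n,m}` of total degree `n` and fermionic degree `m`. -/
def bigraded (n m : ℕ) : Submodule ℚ SuperSym :=
  (symFamily n m).comap toFamily.toLinearMap

/-- The symmetric functions in superspace of fermionic degree `m`. -/
def fermionic (m : ℕ) : Submodule ℚ SuperSym := ⨆ n : ℕ, bigraded n m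

/-- The symmetric functions in superspace of degree `k`, for the simple grading by the sum of the
total degree and the fermionic degree. -/
def simpleDegree (k : ℕ) : Submodule ℚ SuperSym :=
  ⨆ (p : ℕ × ℕ) (_ : p.1 + p.2 = k), bigraded p.1 p.2

theorem one_mem_bigraded : (1 : SuperSym) ∈ bigraded 0 0 := one_mem_symFamily

theorem mul_mem_bigraded {n m n' m' : ℕ} {f g : SuperSym}
    (hf : f ∈ bigraded n m) (hg : g ∈ bigraded n' m') :
    f * g ∈ bigraded (n + n') (m + m') :=
  mul_mem_symFamily hf hg

theorem iSup_bigraded : (⨆ p : ℕ × ℕ, bigraded p.1 p.2) = ⊤ := by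
  refine eq_top_iff.2 ?_
  rintro ⟨f, hf⟩ -
  have key : ∀ g ∈ (⨆ p : ℕ × ℕ, symFamily p.1 p.2),
      g ∈ (⨆ p : ℕ × ℕ, bigraded p.1 p.2).map toFamily.toLinearMap := by
    intro g hg
    refine (iSup_le (fun p g hg => ?_) : (⨆ p : ℕ × ℕ, symFamily p.1 p.2) ≤ _) hg
    exact ⟨⟨g, mem_superSymSubalgebra.2 ((le_iSup (fun p : ℕ × ℕ => symFamily p.1 p.2) p) hg)⟩,
      (le_iSup (fun p : ℕ × ℕ => bigraded p.1 p.2) p) hg, rfl⟩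
  obtain ⟨g, hg, hgf⟩ := key f (mem_superSymSubalgebra.1 hf)
  have : g = ⟨f, hf⟩ := toFamily_injective hgf
  exact this ▸ hg

instance : SetLike.GradedMonoid fermionic where
  one_mem := (le_iSup (fun n => bigraded n 0) 0) one_mem_bigraded
  mul_mem := by
    intro m m' f g hf hg
    have h : fermionic m ≤ (fermionic (m + m')).comap (LinearMap.mulRight ℚ g) := by
      refine iSup_le fun n a ha => ?_
      have h' : fermionic m' ≤ (fermionic (m + m')).comap (LinearMap.mulLeft ℚ a) := by
        refine iSup_le fun n' b hb => ?_
        exact (le_iSup (fun k => bigraded k (m + m')) (n + n')) (mul_mem_bigraded ha hb)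
      exact h' hg
    exact h hf

theorem fermionicPart_apply_of_mem {m : ℕ} {f : SuperSym} (hf : f ∈ fermionic m) (k N : ℕ) :
    fermionicPart (Fin N) k (toFamily f N) = if m = k then toFamily f N else 0 := by
  let ev : SuperSym →ₗ[ℚ] SuperPoly (Fin N) :=
    (LinearMap.proj N : SuperFamily →ₗ[ℚ] SuperPoly (Fin N)) ∘ₗ
      toFamily.toLinearMap
  split_ifs with h
  · subst h
    have h' : fermionic m ≤ LinearMap.eqLocus (fermionicPart (Fin N) m ∘ₗ ev) ev :=
      iSup_le fun n a ha => fermionicPart_of_mem (ha.1 N)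
    exact h' hf
  · have h' : fermionic m ≤ LinearMap.ker (fermionicPart (Fin N) k ∘ₗ ev) :=
      iSup_le fun n a ha => fermionicPart_of_mem_ne h (ha.1 N)
    exact h' hf

theorem isInternal_fermionic : DirectSum.IsInternal fermionic := by
  refine (DirectSum.isInternal_submodule_iff_iSupIndep_and_iSup_eq_top fermionic).2 ⟨?_, ?_⟩
  · intro m
    rw [Submodule.disjoint_def]
    intro f hf hf'
    refine toFamily_injective (funext fun N => ?_)
    let ev : SuperSym →ₗ[ℚ] SuperPoly (Fin N) :=
      (LinearMap.proj N : SuperFamily →ₗ[ℚ] SuperPoly (Fin N)) ∘ₗ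
        toFamily.toLinearMap
    have h : (⨆ j, ⨆ (_ : j ≠ m), fermionic j) ≤
        LinearMap.ker (fermionicPart (Fin N) m ∘ₗ ev) := by
      refine iSup_le fun j => iSup_le fun hj a ha => ?_
      have := fermionicPart_apply_of_mem ha m N
      rw [if_neg hj] at this
      exact this
    have h0 : fermionicPart (Fin N) m (toFamily f N) = 0 := h hf'
    have h1 := fermionicPart_apply_of_mem hf m N
    rw [if_pos rfl] at h1
    exact h1.symm.trans h0
  · refine eq_top_iff.2 (iSup_bigraded.symm.le.trans (iSup_le fun p => ?_))
    exact (le_iSup (fun n => bigraded n p.2) p.1).trans (le_iSup fermionic p.2)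

/-- The grading by the fermionic degree, which governs all the signs. -/
instance : GradedAlgebra fermionic where
  toGradedMonoid := inferInstance
  toDecomposition := isInternal_fermionic.chooseDecomposition

/-! ### Power sums -/

/-- A symmetric function of bidegree `(n|m)` from a family. -/
def ofFamily {n m : ℕ} (f : SuperFamily) (hf : f ∈ symFamily n m) : SuperSym :=
  ⟨f, mem_superSymSubalgebra.2 ((le_iSup (fun p : ℕ × ℕ => symFamily p.1 p.2) (n, m)) hf)⟩

theorem powerSum_mem (r : ℕ+) :
    (fun N => ∑ i : Fin N, x i ^ (r : ℕ) : SuperFamily) ∈ symFamily r 0 := by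
  refine ⟨fun N => sum_mem fun i _ => x_pow_mem_bihomogeneous i r, fun N σ => ?_, fun N => ?_⟩
  · simp only [map_sum, map_pow, subst_x, Option.elim_some]
    exact Equiv.sum_comp σ fun i => x i ^ (r : ℕ)
  · simp [Fin.sum_univ_castSucc, subst_x, dropLast]

theorem oddPowerSum_mem (k : ℕ) :
    (fun N => ∑ i : Fin N, θ i * x i ^ k : SuperFamily) ∈ symFamily k 1 := by
  refine ⟨fun N => sum_mem fun i _ => ?_, fun N σ => ?_, fun N => ?_⟩
  · simpa using mul_mem_bihomogeneous (θ_mem_bihomogeneous i) (x_pow_mem_bihomogeneous i k)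
  · simp only [map_sum, map_mul, map_pow, subst_x, subst_θ, Option.elim_some]
    exact Equiv.sum_comp σ fun i => θ i * x i ^ k
  · simp [Fin.sum_univ_castSucc, subst_x, subst_θ, dropLast]

/-- The power sum `p_r = ∑ x_i ^ r`, `r ≥ 1`. -/
def powerSum (r : ℕ+) : SuperSym := ofFamily _ (powerSum_mem r)

/-- The odd power sum `p̃_k = ∑ θ_i x_i ^ k`, `k ≥ 0`. -/
def oddPowerSum (k : ℕ) : SuperSym := ofFamily _ (oddPowerSum_mem k)

end SuperSym

/-- A superpartition `(Λ^a ; Λ^s)`: the parts of `Λ^a` are distinct nonnegative integers, and `Λ^s`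
is a partition (given by its multiset of positive parts). -/
@[ext]
structure SuperPartition where
  /-- the parts of `Λ^a` -/
  a : Finset ℕ
  /-- the positive parts of `Λ^s` -/
  s : Multiset ℕ+
deriving DecidableEq

namespace SuperPartition

/-- The fermionic degree, i.e. the number of parts of `Λ^a`. -/
def fermionicDegree (L : SuperPartition) : ℕ := L.a.card

/-- `z_{Λ^s} = ∏ i ^ n(i) * n(i)!`, with `n(i)` the number of parts of `Λ^s` equal to `i`. -/
def z (L : SuperPartition) : ℚ :=
  ∏ i ∈ L.s.toFinset, ((i : ℕ) : ℚ) ^ L.s.count i * ((L.s.count i).factorial : ℚ)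

/-- The power sum `p_Λ = p̃_{Λ_1} ⋯ p̃_{Λ_m} p_{Λ_{m+1}} ⋯ p_{Λ_ℓ}`, where
`Λ^a = (Λ_1 > ⋯ > Λ_m)` and `Λ^s = (Λ_{m+1} ≥ ⋯ ≥ Λ_ℓ)`. -/
def powerSum (L : SuperPartition) : SuperSym :=
  ((L.a.sort (· ≥ ·)).map SuperSym.oddPowerSum).prod *
    ((L.s.sort (· ≥ ·)).map SuperSym.powerSum).prod

end SuperPartition

/-! ### Two alphabets -/

namespace SuperSym

/-- `f(x, y; θ, φ)` for the alphabets `(x_1, …, x_N; θ_1, …, θ_N)` and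
`(y_1, …, y_M; φ_1, …, φ_M)`. -/
def evalUnion (f : SuperSym) (N M : ℕ) : SuperPoly (Fin N ⊕ Fin M) :=
  subst (fun i => some (finSumFinEquiv.symm i)) (toFamily f (N + M))

/-- The linear map sending `f ⊗ g` to `f(x; θ) g(y; φ)`, for all alphabets
`(x_1, …, x_N; θ_1, …, θ_N)` and `(y_1, …, y_M; φ_1, …, φ_M)`, the `θ`'s and the `φ`'s
anticommuting. -/
def evalTensor :
    SuperSym ⊗[ℚ] SuperSym →ₗ[ℚ] ((N M : ℕ) → SuperPoly (Fin N ⊕ Fin M)) :=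
  LinearMap.pi fun N => LinearMap.pi fun M =>
    LinearMap.mul' ℚ (SuperPoly (Fin N ⊕ Fin M)) ∘ₗ
      TensorProduct.map
        ((subst fun i => some (Sum.inl i)).toLinearMap ∘ₗ LinearMap.proj N ∘ₗ
          toFamily.toLinearMap)
        ((subst fun j => some (Sum.inr j)).toLinearMap ∘ₗ LinearMap.proj M ∘ₗ
          toFamily.toLinearMap)

theorem evalTensor_tmul (f g : SuperSym) (N M : ℕ) :
    evalTensor (f ⊗ₜ[ℚ] g) N M =
      subst (fun i => some (Sum.inl i)) (toFamily f N) * subst (fun j => some (Sum.inr j)) (toFamily g M) :=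
  rfl

end SuperSym

/-! ### Hopf algebras in the topologist's sense -/

/-- `𝒢 n ⊗ 𝒢' n'` summed over `n + n' = k`, inside `H ⊗ H`. -/
def tensorDegree {K H : Type*} [CommRing K] [Ring H] [Algebra K H] (𝒢 : ℕ → Submodule K H)
    (k : ℕ) : Submodule K (H ⊗[K] H) :=
  ⨆ (p : ℕ × ℕ) (_ : p.1 + p.2 = k),
    LinearMap.range (TensorProduct.map (𝒢 p.1).subtype (𝒢 p.2).subtype)

/-- Hopf algebra structures, in the topologist's sense, on an algebra `H` graded by `𝒜`: the
coproduct and the counit are algebra morphisms, where `H ⊗ H` carries the product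
`(f₁ ⊗ g₁) (f₂ ⊗ g₂) = (-1) ^ (deg g₁ * deg f₂) f₁ f₂ ⊗ g₁ g₂`, and all the structure maps preserve
the degree. -/
structure SuperHopfAlgebra {K H : Type*} [CommRing K] [Ring H] [Algebra K H]
    (𝒜 : ℕ → Submodule K H) [GradedAlgebra 𝒜] extends Coalgebra K H where
  comul_one : GradedTensorProduct.of K 𝒜 𝒜 (comul 1) = 1
  comul_mul : ∀ f g : H, GradedTensorProduct.of K 𝒜 𝒜 (comul (f * g)) =
    GradedTensorProduct.of K 𝒜 𝒜 (comul f) * GradedTensorProduct.of K 𝒜 𝒜 (comul g)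
  counit_one : counit 1 = 1
  counit_mul : ∀ f g : H, counit (f * g) = counit f * counit g
  /-- the antipode -/
  antipode : H →ₗ[K] H
  mul_antipode_rTensor_comul :
    LinearMap.mul' K H ∘ₗ antipode.rTensor H ∘ₗ comul = Algebra.linearMap K H ∘ₗ counit
  mul_antipode_lTensor_comul :
    LinearMap.mul' K H ∘ₗ antipode.lTensor H ∘ₗ comul = Algebra.linearMap K H ∘ₗ counit
  comul_mem : ∀ m, ∀ f ∈ 𝒜 m, comul f ∈ tensorDegree 𝒜 m
  counit_of_mem : ∀ m ≠ 0, ∀ f ∈ 𝒜 m, counit f = 0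
  antipode_mem : ∀ m, ∀ f ∈ 𝒜 m, antipode f ∈ 𝒜 m

namespace SuperHopfAlgebra

variable {K H : Type*} [CommRing K] [Ring H] [Algebra K H]
  {𝒜 : ℕ → Submodule K H} [GradedAlgebra 𝒜]

/-- `τ ∘ Δ = Δ` for the signed twist `τ (g ⊗ h) = (-1) ^ (deg g * deg h) h ⊗ g`. -/
def IsCocommutative (A : SuperHopfAlgebra 𝒜) : Prop :=
  ∀ f : H, GradedTensorProduct.comm 𝒜 𝒜 (GradedTensorProduct.of K 𝒜 𝒜 (A.comul f)) =
    GradedTensorProduct.of K 𝒜 𝒜 (A.comul f)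

/-- The submodules `𝒢 0, 𝒢 1, …` make the bialgebra graded and connected. -/
structure IsGradedConnected (A : SuperHopfAlgebra 𝒜) (𝒢 : ℕ → Submodule K H) : Prop where
  isInternal : DirectSum.IsInternal 𝒢
  mul_mem : ∀ i j, ∀ f ∈ 𝒢 i, ∀ g ∈ 𝒢 j, f * g ∈ 𝒢 (i + j)
  comul_mem : ∀ k, ∀ f ∈ 𝒢 k, A.comul f ∈ tensorDegree 𝒢 k
  finrank_zero : Module.finrank K (𝒢 0) = 1

/-- The pairing `(f ⊗ g, a ⊗ b) ↦ ⟨f, a⟩ ⟨g, b⟩`, without sign. -/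
def plainTensorPairing (B : H →ₗ[K] H →ₗ[K] K) : H ⊗[K] H →ₗ[K] H ⊗[K] H →ₗ[K] K :=
  TensorProduct.curry
    (LinearMap.mul' K K ∘ₗ TensorProduct.map (TensorProduct.lift B) (TensorProduct.lift B) ∘ₗ
      (TensorProduct.tensorTensorTensorComm K H H H H).toLinearMap)

theorem plainTensorPairing_tmul (B : H →ₗ[K] H →ₗ[K] K) (f g a b : H) :
    plainTensorPairing B (f ⊗ₜ g) (a ⊗ₜ b) = B f a * B g b := rfl

variable (𝒜) in
/-- The signed twist `τ (g ⊗ a) = (-1) ^ (deg g * deg a) a ⊗ g`. -/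
def signedTwist : H ⊗[K] H →ₗ[K] H ⊗[K] H :=
  (GradedTensorProduct.of K 𝒜 𝒜).symm.toLinearMap ∘ₗ
    (GradedTensorProduct.comm 𝒜 𝒜).toLinearMap ∘ₗ (GradedTensorProduct.of K 𝒜 𝒜).toLinearMap

variable (𝒜) in
/-- The pairing of `H ⊗ H` with itself that is the composite
`(H ⊗ H) ⊗ (H ⊗ H) → (H ⊗ H) ⊗ (H ⊗ H) → K` of `1 ⊗ τ ⊗ 1`, with the signed twist `τ`, and of
`⟨ , ⟩ ⊗ ⟨ , ⟩`. -/
def signedTensorPairing (B : H →ₗ[K] H →ₗ[K] K) : H ⊗[K] H →ₗ[K] H ⊗[K] H →ₗ[K] K :=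
  TensorProduct.curry
    (LinearMap.mul' K K ∘ₗ TensorProduct.map (TensorProduct.lift B) (TensorProduct.lift B) ∘ₗ
      (TensorProduct.assoc K H H (H ⊗[K] H)).symm.toLinearMap ∘ₗ
      LinearMap.lTensor H
        ((TensorProduct.assoc K H H H).toLinearMap ∘ₗ
          LinearMap.rTensor H (signedTwist 𝒜) ∘ₗ
          (TensorProduct.assoc K H H H).symm.toLinearMap) ∘ₗ
      (TensorProduct.assoc K H H (H ⊗[K] H)).toLinearMap)

theorem signedTensorPairing_tmul (B : H →ₗ[K] H →ₗ[K] K) {i j : ℕ} (f g a b : H)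
    (hg : g ∈ 𝒜 i) (ha : a ∈ 𝒜 j) :
    signedTensorPairing 𝒜 B (f ⊗ₜ g) (a ⊗ₜ b) = (-1) ^ (i * j) * (B f a * B g b) := by
  have h : signedTwist 𝒜 (g ⊗ₜ[K] a) = (-1 : K) ^ (i * j) • (a ⊗ₜ[K] g) := by
    have h := GradedTensorProduct.comm_coe_tmul_coe (R := K) 𝒜 𝒜 ⟨g, hg⟩ ⟨a, ha⟩
    have h' : signedTwist 𝒜 (g ⊗ₜ[K] a) = (((-1 : ℤˣ) ^ (j * i) : ℤˣ) : ℤ) • (a ⊗ₜ[K] g) := h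
    rw [h', mul_comm j i, ← Int.cast_smul_eq_zsmul K]
    simp
  simp [signedTensorPairing, h, TensorProduct.smul_tmul', TensorProduct.tmul_smul, mul_assoc]

/-- The bilinear form `B` pairs the Hopf algebra dually with itself, where `B₂` is the pairing
of `H ⊗ H` with itself that extends `B`. -/
structure IsSelfDualPairing (A : SuperHopfAlgebra 𝒜) (B : H →ₗ[K] H →ₗ[K] K)
    (B₂ : H ⊗[K] H →ₗ[K] H ⊗[K] H →ₗ[K] K) : Prop where
  mul_left : ∀ f g a, B (f * g) a = B₂ (f ⊗ₜ g) (A.comul a)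
  mul_right : ∀ f a b, B f (a * b) = B₂ (A.comul f) (a ⊗ₜ b)
  one_left : ∀ a, B 1 a = A.counit a
  one_right : ∀ f, B f 1 = A.counit f
  antipode : ∀ f a, B (A.antipode f) a = B f (A.antipode a)

end SuperHopfAlgebra

end

open scoped TensorProduct

noncomputable section

open SuperPoly

/-! ### Supercommutativity -/

/-! The ring is the free supercommutative algebra on the even `p_r` (`r ≥ 1`) and the odd `p̃_k` (`k
≥ 0`), and splitting the alphabet in two sends each of these to `q ⊗ 1 + 1 ⊗ q`. Everything else
follows from the generators being primitive.

Independence: evaluate the `x`'s at rational numbers and the `θ`'s at vectors. A Vandermonde choice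
sends the `p̃_k` that occur to basis vectors, so the exterior algebra separates the `Λ^a`. Further
variables with `θ = 0` move the values of the `p_r` freely enough to kill any polynomial relation
among them (`SuperPartition.linearIndependent_powerSum`).

Spanning: in `N` variables, symmetrized monomials are polynomials in power sums, by induction on the
number of letters (`augmentedMonomial_succ`). In a fixed bidegree there are finitely many `p_Λ`, so
evaluation in enough variables is injective on their span, and the representations for different `N`
stabilize (`bigraded_eq_span`).

Coproduct: `f ⊗ g ↦ f(x; θ) g(y; φ)` is an injective algebra morphism from the signed tensor
product. Its range contains `f(x, y; θ, φ)` for each generator, hence for all `f`, which defines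
`comul`. The Hopf axioms are then checked on 1 and propagated through left multiplication by a
generator (`hom_ext`, `comul_gen_mul`).

Duality: for the Hall form, contracting the left factor of the coproduct with a generator `q` gives
the operator adjoint to multiplication by `q` (`hallForm_gen_mul`). It commutes with the coproduct
by coassociativity (`comul_derivation`), so `⟨fg, a⟩ = ⟨f ⊗ g, Δa⟩` follows by induction on `f`. The
signed form reduces to this one because `(i + j choose 2) = (i choose 2) + (j choose 2) + ij`: the
last term is exactly the sign of the signed extension. -/

theorem ExteriorAlgebra.mul_eq_neg_one_pow_smul_mul {M : Type*} [AddCommGroup M] [Module ℚ M]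
    {i j : ℕ} {a b : ExteriorAlgebra ℚ M} (ha : a ∈ ⋀[ℚ]^i M) (hb : b ∈ ⋀[ℚ]^j M) :
    a * b = (-1 : ℚ) ^ (i * j) • (b * a) := by
  have h1 : ∀ (v : M) {j : ℕ} {b : ExteriorAlgebra ℚ M}, b ∈ ⋀[ℚ]^j M →
      ι ℚ v * b = (-1 : ℚ) ^ j • (b * ι ℚ v) := by
    intro v j b hb
    induction hb using Submodule.pow_induction_on_left' with
    | algebraMap r => simp [Algebra.commutes]
    | add x y i hx hy ihx ihy => rw [mul_add, ihx, ihy, add_mul, smul_add]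
    | mem_mul m hm i x hx ih =>
      obtain ⟨w, rfl⟩ := hm
      rw [← mul_assoc, eq_neg_of_add_eq_zero_left (ι_add_mul_swap v w), neg_mul, mul_assoc, ih,
        pow_succ]
      simp [mul_assoc]
  induction ha using Submodule.pow_induction_on_left' with
  | algebraMap r => simp [Algebra.commutes]
  | add x y i hx hy ihx ihy => rw [mul_add, smul_add, ← ihx, ← ihy, add_mul]
  | mem_mul m hm i x hx ih =>
    obtain ⟨w, rfl⟩ := hm
    rw [mul_assoc, ih, mul_smul_comm, ← mul_assoc, h1 w hb, smul_mul_assoc, smul_smul, mul_assoc,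
      ← pow_add, Nat.succ_mul]

namespace SuperPoly

theorem mul_eq_neg_one_pow_smul_mul {I : Type} {n m n' m' : ℕ} {a b : SuperPoly I}
    (ha : a ∈ bihomogeneous I n m) (hb : b ∈ bihomogeneous I n' m') :
    a * b = (-1 : ℚ) ^ (m * m') • (b * a) := by
  have h : bihomogeneous I n m ≤ LinearMap.eqLocus (LinearMap.mulRight ℚ b)
      ((-1 : ℚ) ^ (m * m') • LinearMap.mulLeft ℚ b) := by
    refine Submodule.map₂_le.2 fun p _ w hw => ?_
    have h' : bihomogeneous I n' m' ≤ LinearMap.eqLocus (LinearMap.mulLeft ℚ (p ⊗ₜ[ℚ] w))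
        ((-1 : ℚ) ^ (m * m') • LinearMap.mulRight ℚ (p ⊗ₜ[ℚ] w)) := by
      refine Submodule.map₂_le.2 fun q _ v hv => ?_
      simp [LinearMap.mem_eqLocus, ExteriorAlgebra.mul_eq_neg_one_pow_smul_mul hw hv,
        mul_comm q p]
    exact h' hb
  exact h ha

end SuperPoly

namespace SuperSym

/-- The evaluation in `N` variables. -/
def eval (N : ℕ) : SuperSym →ₐ[ℚ] SuperPoly (Fin N) :=
  (Pi.evalAlgHom ℚ (fun N : ℕ => SuperPoly (Fin N)) N).comp toFamily

theorem eval_apply (N : ℕ) (f : SuperSym) : eval N f = toFamily f N := rfl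

theorem ext_eval {f g : SuperSym} (h : ∀ N, eval N f = eval N g) : f = g :=
  toFamily_injective (funext h)

theorem eval_mem {n m : ℕ} {f : SuperSym} (hf : f ∈ bigraded n m) (N : ℕ) :
    eval N f ∈ bihomogeneous (Fin N) n m := hf.1 N

theorem subst_dropLast_eval (N : ℕ) (f : SuperSym) :
    subst (dropLast N) (eval (N + 1) f) = eval N f := by
  have h : (⨆ p : ℕ × ℕ, bigraded p.1 p.2) ≤ LinearMap.eqLocus
      ((subst (dropLast N)).comp (eval (N + 1))).toLinearMap (eval N).toLinearMap :=
    iSup_le fun p f hf => hf.2.2 N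
  exact h (iSup_bigraded.symm ▸ Submodule.mem_top)

theorem bigraded_le_fermionic (n m : ℕ) : bigraded n m ≤ fermionic m :=
  le_iSup (fun n => bigraded n m) n

theorem mul_eq_neg_one_pow_smul_mul {i j : ℕ} {f g : SuperSym}
    (hf : f ∈ fermionic i) (hg : g ∈ fermionic j) :
    f * g = (-1 : ℚ) ^ (i * j) • (g * f) := by
  have h : fermionic i ≤ LinearMap.eqLocus (LinearMap.mulRight ℚ g)
      ((-1 : ℚ) ^ (i * j) • LinearMap.mulLeft ℚ g) := by
    refine iSup_le fun n a ha => ?_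
    have h' : fermionic j ≤ LinearMap.eqLocus (LinearMap.mulLeft ℚ a)
        ((-1 : ℚ) ^ (i * j) • LinearMap.mulRight ℚ a) := by
      refine iSup_le fun n' b hb => ext_eval fun N => ?_
      simpa using SuperPoly.mul_eq_neg_one_pow_smul_mul (eval_mem ha N) (eval_mem hb N)
    exact h' hg
  exact h hf

theorem powerSum_mem_bigraded (r : ℕ+) : powerSum r ∈ bigraded r 0 := powerSum_mem r

theorem oddPowerSum_mem_bigraded (k : ℕ) : oddPowerSum k ∈ bigraded k 1 := oddPowerSum_mem k

@[simp]
theorem eval_powerSum (N : ℕ) (r : ℕ+) : eval N (powerSum r) = ∑ i : Fin N, x i ^ (r : ℕ) := rfl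

@[simp]
theorem eval_oddPowerSum (N k : ℕ) :
    eval N (oddPowerSum k) = ∑ i : Fin N, θ i * x i ^ k := rfl

/-- The power sums, even and odd. -/
def gen : ℕ+ ⊕ ℕ → SuperSym := Sum.elim powerSum oddPowerSum

/-- The fermionic degree of a power sum. -/
def parity : ℕ+ ⊕ ℕ → ℕ := Sum.elim (fun _ => 0) fun _ => 1

/-- The total degree of a power sum. -/
def genDegree : ℕ+ ⊕ ℕ → ℕ := Sum.elim (fun r => r) fun k => k

theorem gen_mem_bigraded (q : ℕ+ ⊕ ℕ) : gen q ∈ bigraded (genDegree q) (parity q) := by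
  cases q with
  | inl r => exact powerSum_mem_bigraded r
  | inr k => exact oddPowerSum_mem_bigraded k

theorem gen_mem_fermionic (q : ℕ+ ⊕ ℕ) : gen q ∈ fermionic (parity q) :=
  bigraded_le_fermionic _ _ (gen_mem_bigraded q)

theorem powerSum_mul (r : ℕ+) (f : SuperSym) : powerSum r * f = f * powerSum r := by
  have h : (⨆ p : ℕ × ℕ, bigraded p.1 p.2) ≤ LinearMap.eqLocus
      (LinearMap.mulLeft ℚ (powerSum r)) (LinearMap.mulRight ℚ (powerSum r)) := by
    refine iSup_le fun p f hf => ?_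
    simpa [parity, gen] using mul_eq_neg_one_pow_smul_mul (gen_mem_fermionic (.inl r))
      (bigraded_le_fermionic _ _ hf)
  exact h (iSup_bigraded.symm ▸ Submodule.mem_top)

theorem oddPowerSum_mul_oddPowerSum (k j : ℕ) :
    oddPowerSum k * oddPowerSum j = -(oddPowerSum j * oddPowerSum k) := by
  simpa [parity, gen] using
    mul_eq_neg_one_pow_smul_mul (gen_mem_fermionic (.inr k)) (gen_mem_fermionic (.inr j))

theorem oddPowerSum_mul_self (k : ℕ) : oddPowerSum k * oddPowerSum k = 0 := by
  have h := oddPowerSum_mul_oddPowerSum k k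
  rw [eq_neg_iff_add_eq_zero, ← two_smul ℚ] at h
  rw [← one_smul ℚ (oddPowerSum k * oddPowerSum k), show (1 : ℚ) = 2⁻¹ * 2 by norm_num, mul_smul,
    h, smul_zero]

end SuperSym

/-! ### Products of power sums -/

/-- A permutation is a chain of adjacent swaps, each costing a sign. The total sign is never
computed; only that it is `±1` matters later. -/
theorem List.Perm.prod_map_eq_or_eq_neg {α R : Type*} [Ring R] {u : α → R}
    (hu : ∀ i j, u i * u j = -(u j * u i)) {l l' : List α} (h : l.Perm l') :
    (l.map u).prod = (l'.map u).prod ∨ (l.map u).prod = -(l'.map u).prod := by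
  induction h with
  | nil => simp
  | cons i _ ih => rcases ih with h | h <;> simp [h]
  | swap i j l => exact Or.inr (by simp [← mul_assoc, hu j i])
  | trans _ _ ih₁ ih₂ => rcases ih₁ with h | h <;> rcases ih₂ with h' | h' <;> simp [h, h']

theorem List.mul_prod_map_eq_zero {α R : Type*} [Ring R] {u : α → R}
    (hu : ∀ i j, u i * u j = -(u j * u i)) (hu' : ∀ i, u i * u i = 0) {i : α} {l : List α}
    (hi : i ∈ l) : u i * (l.map u).prod = 0 := by
  induction l with
  | nil => simp at hi
  | cons j l ih =>
    rw [List.map_cons, List.prod_cons, ← mul_assoc]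
    rcases List.mem_cons.1 hi with rfl | hi
    · simp [hu']
    · rw [hu i j, neg_mul, mul_assoc, ih hi, mul_zero, neg_zero]

namespace SuperPartition

open SuperSym

/-- The total degree, i.e. the sum of the parts. -/
def totalDegree (L : SuperPartition) : ℕ := ∑ k ∈ L.a, k + (L.s.map PNat.val).sum

/-- The number of parts. -/
def length (L : SuperPartition) : ℕ := L.a.card + Multiset.card L.s

/-- The empty superpartition. -/
def empty : SuperPartition := ⟨∅, 0⟩

/-- Adding the part `r` to `Λ^s`. -/
def addEven (r : ℕ+) (L : SuperPartition) : SuperPartition := ⟨L.a, r ::ₘ L.s⟩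

/-- Adding the part `k` to `Λ^a`. -/
def addOdd (k : ℕ) (L : SuperPartition) : SuperPartition := ⟨insert k L.a, L.s⟩

theorem powerSum_empty : empty.powerSum = 1 := by
  simp [powerSum, empty]

theorem powerSum_mem_bigraded (L : SuperPartition) :
    L.powerSum ∈ bigraded L.totalDegree L.fermionicDegree := by
  have h1 : ∀ l : List ℕ, (l.map oddPowerSum).prod ∈ bigraded l.sum l.length := by
    intro l
    induction l with
    | nil => simpa using one_mem_bigraded
    | cons k l ih =>
      simpa [add_comm l.length] using mul_mem_bigraded (oddPowerSum_mem_bigraded k) ih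
  have h2 : ∀ l : List ℕ+, (l.map SuperSym.powerSum).prod ∈
      bigraded (l.map PNat.val).sum 0 := by
    intro l
    induction l with
    | nil => simpa using one_mem_bigraded
    | cons k l ih => simpa using mul_mem_bigraded (SuperSym.powerSum_mem_bigraded k) ih
  have h := mul_mem_bigraded (h1 (L.a.sort (· ≥ ·))) (h2 (L.s.sort (· ≥ ·)))
  have e1 : (L.a.sort (· ≥ ·)).sum = ∑ k ∈ L.a, k := by
    rw [← Multiset.sum_coe, Finset.sort_eq, ← Multiset.map_id' L.a.val]; rfl
  have e2 : ((L.s.sort (· ≥ ·)).map PNat.val).sum = (L.s.map PNat.val).sum := by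
    rw [← Multiset.sum_coe, ← Multiset.map_coe, Multiset.sort_eq]
  rwa [e1, e2, Finset.length_sort, add_zero] at h

theorem powerSum_mul_powerSum (r : ℕ+) (L : SuperPartition) :
    SuperSym.powerSum r * L.powerSum = (L.addEven r).powerSum := by
  rw [powerSum, ← mul_assoc, powerSum_mul, mul_assoc, powerSum, ← List.prod_cons, ← List.map_cons]
  congr 1
  refine List.Perm.prod_eq' (List.Perm.map _ ?_) ?_
  · rw [← Multiset.coe_eq_coe, ← Multiset.cons_coe, Multiset.sort_eq, Multiset.sort_eq]
    rfl
  · exact List.Pairwise.map _ (fun a b _ => powerSum_mul a _) (R := fun _ _ => True)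
      (List.pairwise_of_forall fun _ _ => trivial)

theorem oddPowerSum_mul_powerSum_of_mem {k : ℕ} {L : SuperPartition} (hk : k ∈ L.a) :
    oddPowerSum k * L.powerSum = 0 := by
  rw [powerSum, ← mul_assoc, List.mul_prod_map_eq_zero oddPowerSum_mul_oddPowerSum
    oddPowerSum_mul_self (by simpa using hk), zero_mul]

/-- The sign comes from sorting `k` into `a`, so one `ε` serves all `s`. This uniformity is used to
compare `p_Λ` before and after removal of an even part. -/
theorem exists_oddPowerSum_mul_powerSum_mk {k : ℕ} {a : Finset ℕ} (hk : k ∉ a) :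
    ∃ ε : ℚ, ε * ε = 1 ∧ ∀ s,
      oddPowerSum k * (mk a s).powerSum = ε • (addOdd k (mk a s)).powerSum := by
  have hp : (k :: a.sort (· ≥ ·)).Perm ((insert k a).sort (· ≥ ·)) := by
    rw [← Multiset.coe_eq_coe, ← Multiset.cons_coe, Finset.sort_eq, Finset.sort_eq,
      Finset.insert_val_of_notMem hk]
  have h1 : ∀ s, oddPowerSum k * (mk a s).powerSum =
      ((k :: a.sort (· ≥ ·)).map oddPowerSum).prod *
        ((s.sort (· ≥ ·)).map SuperSym.powerSum).prod := by
    intro s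
    rw [powerSum, ← mul_assoc, List.map_cons, List.prod_cons]
  rcases hp.prod_map_eq_or_eq_neg oddPowerSum_mul_oddPowerSum with h | h
  · exact ⟨1, by simp, fun s => by rw [h1, h, one_smul]; rfl⟩
  · exact ⟨-1, by simp, fun s => by rw [h1, h, neg_smul, one_smul, neg_mul]; rfl⟩

theorem oddPowerSum_mul_powerSum {k : ℕ} {L : SuperPartition} (hk : k ∉ L.a) :
    ∃ ε : ℚ, ε * ε = 1 ∧ oddPowerSum k * L.powerSum = ε • (L.addOdd k).powerSum := by
  obtain ⟨ε, hε, h⟩ := exists_oddPowerSum_mul_powerSum_mk hk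
  exact ⟨ε, hε, h L.s⟩

theorem length_addEven (r : ℕ+) (L : SuperPartition) :
    (L.addEven r).length = L.length + 1 := by
  simp [length, addEven, add_assoc]

theorem length_addOdd {k : ℕ} {L : SuperPartition} (hk : k ∉ L.a) :
    (L.addOdd k).length = L.length + 1 := by
  simp [length, addOdd, hk, add_right_comm]

/-- Induction on superpartitions, adding one part at a time. -/
theorem induction {P : SuperPartition → Prop} (h0 : P empty)
    (h1 : ∀ r L, P L → P (addEven r L)) (h2 : ∀ k L, k ∉ L.a → P L → P (addOdd k L))
    (L : SuperPartition) : P L := by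
  obtain ⟨a, s⟩ := L
  induction s using Multiset.induction with
  | empty =>
    induction a using Finset.induction with
    | empty => exact h0
    | insert k a hk ih => exact h2 k ⟨a, 0⟩ hk ih
  | cons r s ih => exact h1 r ⟨a, s⟩ ih

end SuperPartition

namespace SuperSym

/-- The span of the `p_Λ` is stable under multiplication by power sums. -/
theorem gen_mul_mem_span (q : ℕ+ ⊕ ℕ) {f : SuperSym}
    (hf : f ∈ Submodule.span ℚ (Set.range SuperPartition.powerSum)) :
    gen q * f ∈ Submodule.span ℚ (Set.range SuperPartition.powerSum) := by
  have h : Submodule.span ℚ (Set.range SuperPartition.powerSum) ≤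
      (Submodule.span ℚ (Set.range SuperPartition.powerSum)).comap
        (LinearMap.mulLeft ℚ (gen q)) := by
    refine Submodule.span_le.2 ?_
    rintro _ ⟨L, rfl⟩
    cases q with
    | inl r => exact Submodule.subset_span ⟨_, (L.powerSum_mul_powerSum r).symm⟩
    | inr k =>
      by_cases hk : k ∈ L.a
      · have := SuperPartition.oddPowerSum_mul_powerSum_of_mem hk
        simp [gen, this]
      · obtain ⟨ε, -, h⟩ := SuperPartition.oddPowerSum_mul_powerSum hk
        simp only [gen, SetLike.mem_coe, Submodule.mem_comap,
          LinearMap.mulLeft_apply, Sum.elim_inr, h]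
        exact Submodule.smul_mem _ _ (Submodule.subset_span ⟨_, rfl⟩)
  exact h hf

theorem one_mem_span :
    (1 : SuperSym) ∈ Submodule.span ℚ (Set.range SuperPartition.powerSum) :=
  Submodule.subset_span ⟨_, SuperPartition.powerSum_empty⟩

end SuperSym

/-! ### Linear independence of the power sum products -/

/-- Superpartitions list their parts in decreasing order, the standard basis of the exterior algebra
in increasing order; the two families differ by signs, which are units. -/
theorem ExteriorAlgebra.linearIndependent_prod_sort {M : Type*} [AddCommGroup M] [Module ℚ M]
    (b : Module.Basis ℕ ℚ M) :
    LinearIndependent ℚ fun a : Finset ℕ =>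
      ((a.sort (· ≥ ·)).map fun k => ι ℚ (b k)).prod := by
  have h : ∀ a : Finset ℕ, ∃ ε : ℚˣ,
      ((a.sort (· ≥ ·)).map fun k => ι ℚ (b k)).prod = ε • b.ExteriorAlgebra a := by
    intro a
    have hb : b.ExteriorAlgebra a =
        ((List.ofFn (a.orderEmbOfFin rfl)).map fun k => ι ℚ (b k)).prod := by
      rw [ExteriorAlgebra.basis_apply, List.map_ofFn]
      exact ιMulti_apply _
    have hp : (a.sort (· ≥ ·)).Perm (List.ofFn (a.orderEmbOfFin rfl)) := by
      refine List.perm_of_nodup_nodup_toFinset_eq (Finset.sort_nodup _ _)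
        (List.nodup_ofFn.2 (a.orderEmbOfFin rfl).injective) ?_
      ext i
      have : i ∈ Set.range (a.orderEmbOfFin rfl) ↔ i ∈ a := by
        rw [Finset.range_orderEmbOfFin, Finset.mem_coe]
      rw [List.mem_toFinset, List.mem_toFinset, List.mem_ofFn', this, Finset.mem_sort]
    rw [hb]
    rcases hp.prod_map_eq_or_eq_neg (u := fun k => ι ℚ (b k))
      (fun i j => eq_neg_of_add_eq_zero_left (ι_add_mul_swap _ _)) with h | h
    · exact ⟨1, by simp [h]⟩
    · exact ⟨-1, by simp [h]⟩
  choose ε hε using h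
  simp_rw [hε]
  exact b.ExteriorAlgebra.linearIndependent.units_smul ε

/-- A polynomial in `z_1, z_2, …` that vanishes at all the translates of a point by sums of vectors
`(y, y ^ 2, …)` is zero. -/
theorem MvPolynomial.eq_zero_of_eval_add_sum_pow (F : MvPolynomial ℕ+ ℚ) (P : ℕ+ → ℚ)
    (h : ∀ (n : ℕ) (m : Fin n → ℕ),
      eval (fun r : ℕ+ => P r + ∑ j : Fin n, (m j : ℚ) * ((j : ℕ) + 1 : ℚ) ^ (r : ℕ)) F = 0) : F = 0 := by
  refine MvPolynomial.funext fun z => ?_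
  rw [map_zero]
  -- Only the variables of index at most `n` occur in `F`, so `n` translation parameters are enough.
  obtain ⟨n, hn⟩ : ∃ n : ℕ, ∀ r ∈ F.vars, (r : ℕ) ≤ n :=
    ⟨F.vars.sup PNat.val, fun r hr => Finset.le_sup (f := PNat.val) hr⟩
  let φ : MvPolynomial ℕ+ ℚ →ₐ[ℚ] MvPolynomial (Fin n) ℚ :=
    aeval fun r => C (P r) + ∑ j : Fin n, X j * C (((j : ℕ) + 1 : ℚ) ^ (r : ℕ))
  have hφ : ∀ m : Fin n → ℚ, eval m (φ F) =
      eval (fun r : ℕ+ => P r + ∑ j : Fin n, m j * ((j : ℕ) + 1 : ℚ) ^ (r : ℕ)) F := by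
    intro m
    have : (aeval m).comp φ =
        aeval (fun r : ℕ+ => P r + ∑ j : Fin n, m j * ((j : ℕ) + 1 : ℚ) ^ (r : ℕ)) := by
      ext r
      simp [φ]
    have h := DFunLike.congr_fun this F
    simpa [aeval_eq_eval] using h
  -- As a polynomial in the multiplicities, `F` vanishes on `ℕ^n`, which is Zariski dense; so the
  -- multiplicities may be taken rational.
  have hφ0 : φ F = 0 := by
    refine funext_set (fun _ => Set.range ((↑) : ℕ → ℚ))
      (fun _ => Set.infinite_range_of_injective Nat.cast_injective) fun x hx => ?_
    choose m hm using fun i => hx i trivial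
    obtain rfl : (fun i => (m i : ℚ)) = x := _root_.funext hm
    rw [hφ, map_zero]
    exact h n m
  have hdet : IsUnit (Matrix.vandermonde fun j : Fin n => ((j : ℕ) + 1 : ℚ)).transpose := by
    rw [Matrix.isUnit_iff_isUnit_det, Matrix.det_transpose, isUnit_iff_ne_zero,
      Matrix.det_vandermonde_ne_zero_iff]
    intro i j hij
    exact Fin.ext (by simpa using hij)
  obtain ⟨w, hw⟩ := Matrix.mulVec_surjective_iff_isUnit.2 hdet
    fun i : Fin n => z (Nat.succPNat i) - P (Nat.succPNat i)
  -- The Vandermonde matrix has exponents `0, …, n - 1`, the power sums have exponents `1, …, n`;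
  -- dividing by the node `j + 1` makes up for the shift.
  have hm := hφ fun j => w j / ((j : ℕ) + 1 : ℚ)
  rw [hφ0, map_zero] at hm
  rw [hm]
  refine eval₂Hom_congr' rfl (fun r hr _ => ?_) rfl
  have hr1 : (r : ℕ) - 1 < n := by have := hn r hr; have := r.pos; omega
  have hr2 : Nat.succPNat (r - 1 : ℕ) = r := by
    refine PNat.coe_injective ?_
    rw [Nat.succPNat_coe]; exact Nat.succ_pred_eq_of_pos r.pos
  have h1 := congrFun hw ⟨r - 1, hr1⟩
  simp only [hr2] at h1
  rw [← sub_eq_iff_eq_add', ← h1, Matrix.mulVec, dotProduct]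
  refine Finset.sum_congr rfl fun j _ => ?_
  have hj : ((j : ℕ) + 1 : ℚ) ≠ 0 := by positivity
  obtain ⟨s, hs⟩ : ∃ s, (r : ℕ) = s + 1 := ⟨r - 1, by have := r.pos; omega⟩
  rw [Matrix.transpose_apply, Matrix.vandermonde_apply]
  simp only [hs, Nat.add_sub_cancel, pow_succ]
  field_simp

namespace SuperPoly

/-- The evaluation of the `x`'s at numbers and of the `θ`'s at vectors. -/
def evalPoint {I : Type} {V : Type*} [AddCommGroup V] [Module ℚ V] (z : I → ℚ) (c : I → V) :
    SuperPoly I →ₐ[ℚ] ExteriorAlgebra ℚ V :=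
  Algebra.TensorProduct.lift ((Algebra.ofId ℚ _).comp (MvPolynomial.aeval z))
    (ExteriorAlgebra.map (Finsupp.linearCombination ℚ c))
    fun p _ => by
      rw [AlgHom.comp_apply, Algebra.ofId_apply]
      exact Algebra.commute_algebraMap_left _ _

@[simp]
theorem evalPoint_x {I : Type} {V : Type*} [AddCommGroup V] [Module ℚ V] (z : I → ℚ) (c : I → V)
    (i : I) : evalPoint z c (x i) = algebraMap ℚ _ (z i) := by
  rw [evalPoint, x, Algebra.TensorProduct.lift_tmul, map_one, mul_one, AlgHom.comp_apply,
    MvPolynomial.aeval_X, Algebra.ofId_apply]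

@[simp]
theorem evalPoint_θ {I : Type} {V : Type*} [AddCommGroup V] [Module ℚ V] (z : I → ℚ) (c : I → V)
    (i : I) : evalPoint z c (θ i) = ExteriorAlgebra.ι ℚ (c i) := by
  rw [evalPoint, θ, Algebra.TensorProduct.lift_tmul, map_one, one_mul,
    ExteriorAlgebra.map_apply_ι, Finsupp.linearCombination_single, one_smul]

end SuperPoly

theorem SuperPartition.evalPoint_powerSum {N : ℕ} {V : Type*} [AddCommGroup V] [Module ℚ V]
    (z : Fin N → ℚ) (c : Fin N → V) (L : SuperPartition) :
    evalPoint z c (SuperSym.eval N L.powerSum) =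
      (L.s.map fun r : ℕ+ => ∑ i, z i ^ (r : ℕ)).prod •
        ((L.a.sort (· ≥ ·)).map fun k => ExteriorAlgebra.ι ℚ (∑ i, z i ^ k • c i)).prod := by
  have h1 : evalPoint z c (SuperSym.eval N ((L.a.sort (· ≥ ·)).map SuperSym.oddPowerSum).prod) =
      ((L.a.sort (· ≥ ·)).map fun k => ExteriorAlgebra.ι ℚ (∑ i, z i ^ k • c i)).prod := by
    rw [map_list_prod, map_list_prod, List.map_map, List.map_map]
    congr 2
    funext k
    simp only [Function.comp_apply, SuperSym.eval_oddPowerSum, map_sum, map_mul, map_pow,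
      evalPoint_θ, evalPoint_x, map_smul]
    refine Finset.sum_congr rfl fun i _ => ?_
    rw [← map_pow, ← Algebra.commutes, ← Algebra.smul_def]
  have h2 : evalPoint z c (SuperSym.eval N ((L.s.sort (· ≥ ·)).map SuperSym.powerSum).prod) =
      algebraMap ℚ _ (L.s.map fun r : ℕ+ => ∑ i, z i ^ (r : ℕ)).prod := by
    conv_rhs => rw [← Multiset.sort_eq L.s (· ≥ ·), Multiset.map_coe, Multiset.prod_coe]
    rw [map_list_prod, map_list_prod, map_list_prod, List.map_map, List.map_map, List.map_map]
    congr 2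
    funext k
    simp only [Function.comp_apply, SuperSym.eval_powerSum, map_sum, map_pow, evalPoint_x]
  rw [powerSum, map_mul, map_mul, h1, h2, ← Algebra.commutes, ← Algebra.smul_def]

/-- The vectors are read off the inverse of the Vandermonde matrix with nodes `0, …, K - 1`. The
node 0 is harmless: the exponent starts at 0 and `0 ^ 0 = 1`. -/
theorem exists_sum_pow_smul_eq_single (K : ℕ) :
    ∃ c : Fin K → (ℕ →₀ ℚ), ∀ k < K,
      ∑ i : Fin K, ((i : ℕ) : ℚ) ^ k • c i = Finsupp.single k 1 := by
  have hdet : IsUnit (Matrix.vandermonde fun j : Fin K => ((j : ℕ) : ℚ)).det := by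
    rw [isUnit_iff_ne_zero, Matrix.det_vandermonde_ne_zero_iff]
    intro i j hij
    exact Fin.ext (by simpa using hij)
  set A := Matrix.vandermonde fun j : Fin K => ((j : ℕ) : ℚ) with hA
  refine ⟨fun i => ∑ j : Fin K, A⁻¹ j i • Finsupp.single (j : ℕ) 1, fun k hk => ?_⟩
  have h1 : ∀ j : Fin K, ∑ i : Fin K, A⁻¹ j i * ((i : ℕ) : ℚ) ^ k = if j = ⟨k, hk⟩ then 1 else 0 := by
    intro j
    have := congrFun (congrFun (Matrix.nonsing_inv_mul A hdet) j) ⟨k, hk⟩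
    simpa [Matrix.mul_apply, hA, Matrix.vandermonde_apply, Matrix.one_apply] using this
  simp_rw [Finset.smul_sum, smul_smul]
  rw [Finset.sum_comm]
  simp_rw [← Finset.sum_smul, mul_comm (_ ^ _), h1]
  simp

theorem SuperPartition.linearIndependent_powerSum :
    LinearIndependent ℚ SuperPartition.powerSum := by
  classical
  rw [linearIndependent_iff']
  intro S l hl L₀ hL₀
  obtain ⟨K, hK⟩ : ∃ K : ℕ, ∀ L ∈ S, ∀ k ∈ L.a, k < K := by
    refine ⟨S.sup fun L => L.a.sup (· + 1), fun L hL k hk => ?_⟩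
    exact lt_of_lt_of_le (Nat.lt_succ_self k)
      ((Finset.le_sup (f := (· + 1)) hk).trans
        (Finset.le_sup (f := fun L : SuperPartition => L.a.sup (· + 1)) hL))
  obtain ⟨c, hc⟩ := exists_sum_pow_smul_eq_single K
  -- The part of the relation with the same `Λ^a` as `L₀`, with each `p_r` replaced by a free
  -- variable. Its coefficient at the monomial of `L₀` is the one to be shown zero.
  let F : MvPolynomial ℕ+ ℚ := ∑ L ∈ S with L.a = L₀.a, MvPolynomial.monomial L.s.toFinsupp (l L)
  have hF : F = 0 := by
    refine MvPolynomial.eq_zero_of_eval_add_sum_pow F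
      (fun r => ∑ i : Fin K, ((i : ℕ) : ℚ) ^ (r : ℕ)) fun n m => ?_
    -- The alphabet has `K` variables that carry the vectors `c`, and `m j` copies of the point `x =
    -- j + 1`, `θ = 0`. The copies shift the `p_r` and leave the `p̃_k` unchanged.
    let e := Fintype.equivFin (Fin K ⊕ Σ j : Fin n, Fin (m j))
    set N := Fintype.card (Fin K ⊕ Σ j : Fin n, Fin (m j))
    let z : Fin N → ℚ := fun i =>
      Sum.elim (fun i : Fin K => ((i : ℕ) : ℚ)) (fun p => ((p.1 : ℕ) + 1 : ℚ)) (e.symm i)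
    let d : Fin N → (ℕ →₀ ℚ) := fun i => Sum.elim c (fun _ => 0) (e.symm i)
    have hd : ∀ k < K, ∑ i, z i ^ k • d i = Finsupp.single k 1 := by
      intro k hk
      rw [← hc k hk, ← e.sum_comp]
      simp [z, d]
    have hz : ∀ r : ℕ+, ∑ i, z i ^ (r : ℕ) = ∑ i : Fin K, ((i : ℕ) : ℚ) ^ (r : ℕ) +
        ∑ j : Fin n, (m j : ℚ) * ((j : ℕ) + 1 : ℚ) ^ (r : ℕ) := by
      intro r
      rw [← e.sum_comp]
      simp [z, Fintype.sum_sigma]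
    simp_rw [← hz]
    have h0 := congrArg (fun f => evalPoint z d (SuperSym.eval N f)) hl
    rw [map_sum, map_sum, map_zero, map_zero] at h0
    simp only [map_smul, evalPoint_powerSum] at h0
    -- Grouping by `Λ^a` turns the relation into one between basis elements of the exterior algebra,
    -- so the scalar in front of each of them vanishes.
    have h1 : ∑ a ∈ S.image SuperPartition.a,
        (∑ L ∈ S with L.a = a, l L * (L.s.map fun r : ℕ+ => ∑ i, z i ^ (r : ℕ)).prod) •
          ((a.sort (· ≥ ·)).map fun k => ExteriorAlgebra.ι ℚ
            (Finsupp.basisSingleOne (R := ℚ) k)).prod = 0 := by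
      rw [← h0, ← Finset.sum_fiberwise_of_maps_to (g := SuperPartition.a)
        (t := S.image SuperPartition.a) fun L hL => Finset.mem_image_of_mem _ hL]
      refine Finset.sum_congr rfl fun a _ => ?_
      rw [Finset.sum_smul]
      refine Finset.sum_congr rfl fun L hL => ?_
      obtain ⟨hLS, rfl⟩ := Finset.mem_filter.1 hL
      rw [mul_smul]
      congr 3
      refine List.map_congr_left fun k hk => ?_
      rw [hd k (hK L hLS k (by simpa using hk)), Finsupp.coe_basisSingleOne]
    have h2 := linearIndependent_iff'.1 (ExteriorAlgebra.linearIndependent_prod_sort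
      (Finsupp.basisSingleOne (R := ℚ) (ι := ℕ))) _ _ h1 L₀.a
      (Finset.mem_image_of_mem _ hL₀)
    rw [← h2, map_sum]
    refine Finset.sum_congr rfl fun L _ => ?_
    rw [MvPolynomial.eval_monomial, Finsupp.prod, Multiset.toFinsupp_support,
      Finset.prod_multiset_map_count]
    simp
  have h3 := congrArg (MvPolynomial.coeff L₀.s.toFinsupp) hF
  rw [MvPolynomial.coeff_sum, MvPolynomial.coeff_zero, Finset.sum_eq_single L₀] at h3
  · simpa using h3
  · intro L hL hne
    rw [MvPolynomial.coeff_monomial, if_neg]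
    intro h
    exact hne (SuperPartition.ext (Finset.mem_filter.1 hL).2 (Multiset.toFinsupp.injective h))
  · simp [hL₀]

/-! ### The power sum products span -/

namespace SuperPoly

theorem adjoin_x_union_θ (I : Type) :
    Algebra.adjoin ℚ (Set.range (x : I → SuperPoly I) ∪ Set.range θ) = ⊤ := by
  set A := Algebra.adjoin ℚ (Set.range (x : I → SuperPoly I) ∪ Set.range θ)
  have hp : ∀ p : MvPolynomial I ℚ, p ⊗ₜ[ℚ] (1 : ExteriorAlgebra ℚ (I →₀ ℚ)) ∈ A := by
    intro p
    have h : ⊤ ≤ A.comap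
        (Algebra.TensorProduct.includeLeft : MvPolynomial I ℚ →ₐ[ℚ] SuperPoly I) := by
      rw [← MvPolynomial.adjoin_range_X, Algebra.adjoin_le_iff]
      rintro _ ⟨i, rfl⟩
      exact Algebra.subset_adjoin (Or.inl ⟨i, rfl⟩)
    exact h (Algebra.mem_top (x := p))
  have hw : ∀ w : ExteriorAlgebra ℚ (I →₀ ℚ), (1 : MvPolynomial I ℚ) ⊗ₜ[ℚ] w ∈ A := by
    intro w
    have h : ⊤ ≤ A.comap (Algebra.TensorProduct.includeRight :
        ExteriorAlgebra ℚ (I →₀ ℚ) →ₐ[ℚ] SuperPoly I) := by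
      rw [← CliffordAlgebra.adjoin_range_ι, Algebra.adjoin_le_iff]
      rintro _ ⟨v, rfl⟩
      suffices hv : ⊤ ≤ (Subalgebra.toSubmodule A).comap
          ((Algebra.TensorProduct.includeRight :
            ExteriorAlgebra ℚ (I →₀ ℚ) →ₐ[ℚ] SuperPoly I).toLinearMap ∘ₗ ExteriorAlgebra.ι ℚ)  from
        hv (Submodule.mem_top (x := v))
      rw [← (Finsupp.basisSingleOne (R := ℚ) (ι := I)).span_eq, Submodule.span_le]
      rintro _ ⟨i, rfl⟩
      refine Algebra.subset_adjoin (Or.inr ⟨i, ?_⟩)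
      simp [θ]
    exact h (Algebra.mem_top (x := w))
  refine eq_top_iff.2 fun a _ => ?_
  induction a using TensorProduct.induction_on with
  | zero => exact zero_mem A
  | tmul p w => simpa using mul_mem (hp p) (hw w)
  | add a b ha hb => exact add_mem (ha trivial) (hb trivial)

/-- The letter `θ_i ^ ε x_i ^ k`, for `c = (k, ε)`. -/
def letter {I : Type} (i : I) (c : ℕ × ℕ) : SuperPoly I := θ i ^ c.2 * x i ^ c.1

theorem letter_mem_bihomogeneous {I : Type} (i : I) (c : ℕ × ℕ) :
    letter i c ∈ bihomogeneous I c.1 c.2 := by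
  have h : ∀ m, θ i ^ m ∈ bihomogeneous I 0 m := by
    intro m
    induction m with
    | zero => simpa using one_mem_bihomogeneous I
    | succ m ih =>
      have h := mul_mem_bihomogeneous ih (θ_mem_bihomogeneous i)
      rwa [← pow_succ, add_zero] at h
  simpa [letter] using mul_mem_bihomogeneous (h c.2) (x_pow_mem_bihomogeneous i c.1)

theorem letter_mul_letter {I : Type} (i : I) (c d : ℕ × ℕ) :
    letter i c * letter i d = letter i (c + d) := by
  have h : Commute (x i ^ c.1) (θ i ^ d.2) := Commute.pow_pow (x_mul_θ i i) _ _
  simp only [letter, Prod.snd_add, Prod.fst_add, pow_add]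
  rw [mul_assoc, ← mul_assoc (x i ^ c.1), h.eq]
  simp only [mul_assoc]

@[simp]
theorem letter_zero {I : Type} (i : I) : letter i 0 = 1 := by simp [letter]

theorem subst_letter {I J : Type} (g : I → J) (i : I) (c : ℕ × ℕ) :
    subst (fun i => some (g i)) (letter i c) = letter (g i) c := by
  simp [letter, subst_x, subst_θ]

/-- The word `∏ θ_{j(t)} ^ ε(t) x_{j(t)} ^ k(t)`. -/
def word {I : Type} {n : ℕ} (c : Fin n → ℕ × ℕ) (j : Fin n → I) : SuperPoly I :=
  (List.ofFn fun t => letter (j t) (c t)).prod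

theorem word_succ {I : Type} {n : ℕ} (c : Fin (n + 1) → ℕ × ℕ) (j : Fin (n + 1) → I) :
    word c j = letter (j 0) (c 0) * word (fun t => c t.succ) (fun t => j t.succ) := by
  simp [word, List.ofFn_succ]

theorem subst_word {I J : Type} (g : I → J) {n : ℕ} (c : Fin n → ℕ × ℕ) (j : Fin n → I) :
    subst (fun i => some (g i)) (word c j) = word c (g ∘ j) := by
  rw [word, map_list_prod, List.map_ofFn, word]
  congr 2
  funext t
  exact subst_letter g _ _

/-- The new letter moves past the earlier ones and merges with the letter of the same index. The
sign depends on the exponents only, not on `j`, so it factors out of sums over `j`. -/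
theorem exists_letter_mul_word {I : Type} {n : ℕ} (c : Fin n → ℕ × ℕ) (t : Fin n) (d : ℕ × ℕ) :
    ∃ ε : ℚ, ∀ j : Fin n → I,
      letter (j t) d * word c j = ε • word (Function.update c t (d + c t)) j := by
  induction n with
  | zero => exact t.elim0
  | succ n ih =>
    cases t using Fin.cases with
    | zero =>
      refine ⟨1, fun j => ?_⟩
      rw [one_smul, word_succ, word_succ, ← mul_assoc, letter_mul_letter]
      simp
    | succ t =>
      obtain ⟨ε, h⟩ := ih (fun t => c t.succ) t
      refine ⟨(-1) ^ (d.2 * (c 0).2) * ε, fun j => ?_⟩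
      rw [word_succ, ← mul_assoc, mul_eq_neg_one_pow_smul_mul (letter_mem_bihomogeneous _ d)
        (letter_mem_bihomogeneous _ (c 0)), smul_mul_assoc, mul_assoc, h fun t => j t.succ,
        mul_smul_comm, smul_smul, word_succ, Function.update_of_ne (Fin.succ_ne_zero t).symm]
      congr 3
      funext s
      by_cases hs : s = t
      · subst hs; simp
      · rw [Function.update_of_ne hs, Function.update_of_ne fun h => hs (Fin.succ_injective _ h)]

/-- The span of the words with one letter per variable contains 1 and is stable under left
multiplication by letters, hence under left multiplication by the algebra that the variables
generate. -/
theorem span_range_word (N : ℕ) :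
    Submodule.span ℚ (Set.range fun c => word (I := Fin N) c id) = ⊤ := by
  set T := Submodule.span ℚ (Set.range fun c => word (I := Fin N) c id) with hT
  have hl : ∀ i c, ∀ b ∈ T, letter i c * b ∈ T := by
    intro i c
    change T ≤ T.comap (LinearMap.mulLeft ℚ (letter i c))
    rw [hT, Submodule.span_le]
    rintro _ ⟨d, rfl⟩
    obtain ⟨ε, h⟩ := exists_letter_mul_word (I := Fin N) d i c
    have := h id
    simp only [id] at this
    simp only [SetLike.mem_coe, Submodule.mem_comap, LinearMap.mulLeft_apply, this]
    exact Submodule.smul_mem _ _ (Submodule.subset_span ⟨_, rfl⟩)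
  have h1 : (1 : SuperPoly (Fin N)) ∈ T := Submodule.subset_span ⟨0, by simp [word]⟩
  refine eq_top_iff.2 fun a _ => ?_
  have key : ∀ b ∈ T, a * b ∈ T := by
    have ha : a ∈ Algebra.adjoin ℚ (Set.range (x : Fin N → SuperPoly (Fin N)) ∪ Set.range θ) := by
      rw [adjoin_x_union_θ]; trivial
    induction ha using Algebra.adjoin_induction with
    | mem a ha =>
      rcases ha with ⟨i, rfl⟩ | ⟨i, rfl⟩
      · simpa [letter] using hl i (1, 0)
      · simpa [letter] using hl i (0, 1)
    | algebraMap r =>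
      intro b hb
      rw [← Algebra.smul_def]
      exact T.smul_mem r hb
    | add a b _ _ ha hb =>
      intro c hc
      rw [add_mul]
      exact add_mem (ha trivial c hc) (hb trivial c hc)
    | mul a b _ _ ha hb =>
      intro c hc
      rw [mul_assoc]
      exact ha trivial _ (hb trivial c hc)
  simpa using key 1 h1

/-- The augmented monomial symmetric function, i.e. the sum of the words
over all injective sequences of indices. -/
def augmentedMonomial (N : ℕ) {n : ℕ} (c : Fin n → ℕ × ℕ) : SuperPoly (Fin N) :=
  ∑ j : Fin n ↪ Fin N, word c j

/-- An index for the first letter that avoids the others is an arbitrary index minus the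
coincidences. The free choice is a power sum factor; each coincidence leaves a word one letter
shorter after merging. -/
theorem augmentedMonomial_succ (N : ℕ) {n : ℕ} (c : Fin (n + 1) → ℕ × ℕ) :
    augmentedMonomial N c = (∑ i, letter i (c 0)) * augmentedMonomial N (fun t => c t.succ) -
      ∑ t, ∑ j : Fin n ↪ Fin N, letter (j t) (c 0) * word (fun t => c t.succ) j := by
  have h : ∀ j : Fin n ↪ Fin N,
      ∑ i : {i // i ∉ Set.range j}, letter (i : Fin N) (c 0) =
        ∑ i, letter i (c 0) - ∑ t, letter (j t) (c 0) := by
    intro j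
    have h1 : ∑ i : {i // i ∈ Set.range j}, letter (i : Fin N) (c 0) +
        ∑ i : {i // i ∉ Set.range j}, letter (i : Fin N) (c 0) = ∑ i, letter i (c 0) := by
      rw [← Fintype.sum_subtype_add_sum_subtype (fun i => i ∈ Set.range j)]
      congr!
    have h2 : ∑ i : {i // i ∈ Set.range j}, letter (i : Fin N) (c 0) =
        ∑ t, letter (j t) (c 0) :=
      ((Equiv.ofInjective j j.injective).sum_comp fun i => letter (i : Fin N) (c 0)).symm
    exact eq_sub_of_add_eq' ((congrArg (· + _) h2.symm).trans h1)
  rw [augmentedMonomial, ← (Equiv.embeddingFinSucc n (Fin N)).symm.sum_comp, Fintype.sum_sigma,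
    augmentedMonomial, Finset.mul_sum, Finset.sum_comm, ← Finset.sum_sub_distrib]
  refine Finset.sum_congr rfl fun j _ => ?_
  rw [← Finset.sum_mul, ← sub_mul, ← h, Finset.sum_mul]
  refine Finset.sum_congr rfl fun i _ => ?_
  rw [word_succ, Equiv.coe_embeddingFinSucc_symm]
  rfl

end SuperPoly

/-! ### Invariants in finitely many variables. -/

namespace SuperSym

theorem sum_letter_mul_mem (N : ℕ) (c : ℕ × ℕ) {b : SuperPoly (Fin N)}
    (hb : b ∈ (Submodule.span ℚ (Set.range SuperPartition.powerSum)).map (eval N).toLinearMap) :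
    (∑ i, letter i c) * b ∈
      (Submodule.span ℚ (Set.range SuperPartition.powerSum)).map (eval N).toLinearMap := by
  obtain ⟨f, hf, rfl⟩ := hb
  obtain ⟨k, ε⟩ := c
  match ε with
  | 0 =>
    -- The exponent 0 without `θ` gives the scalar `N` rather than a generator: there is no `p_0`.
    rcases Nat.eq_zero_or_pos k with rfl | hk
    · have h : ∑ i : Fin N, letter i (0, 0) = algebraMap ℚ (SuperPoly (Fin N)) N := by
        simp [letter]
      rw [h, ← Algebra.smul_def]
      exact Submodule.smul_mem _ _ ⟨f, hf, rfl⟩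
    · refine ⟨_, gen_mul_mem_span (.inl ⟨k, hk⟩) hf, ?_⟩
      have h : ∑ i : Fin N, letter i (k, 0) = eval N (gen (.inl ⟨k, hk⟩)) := by
        simp only [letter, pow_zero, one_mul]
        rfl
      rw [h]
      exact map_mul (eval N) _ _
  | 1 =>
    refine ⟨_, gen_mul_mem_span (.inr k) hf, ?_⟩
    simp [gen, letter]
  | ε + 2 =>
    have h : ∀ i : Fin N, letter i (k, ε + 2) = 0 := by
      intro i
      have h2 : θ i * θ i = 0 := by simp [θ]
      simp [letter, pow_add, pow_two, h2]
    simp only [h, Finset.sum_const_zero, zero_mul]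
    exact zero_mem _

theorem augmentedMonomial_mem (N : ℕ) {n : ℕ} (c : Fin n → ℕ × ℕ) :
    augmentedMonomial N c ∈
      (Submodule.span ℚ (Set.range SuperPartition.powerSum)).map (eval N).toLinearMap := by
  induction n with
  | zero => exact ⟨1, one_mem_span, by simp [augmentedMonomial, word]⟩
  | succ n ih =>
    rw [augmentedMonomial_succ]
    refine sub_mem (sum_letter_mul_mem N _ (ih _)) (sum_mem fun t _ => ?_)
    obtain ⟨ε, h⟩ := exists_letter_mul_word (I := Fin N) (fun t => c t.succ) t (c 0)
    simp_rw [h, ← Finset.smul_sum]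
    exact Submodule.smul_mem _ _ (ih _)

/-- Symmetrization multiplies an invariant by `N!` and sends the spanning words to augmented
monomials. -/
theorem mem_map_eval_of_invariant {N : ℕ} {f : SuperPoly (Fin N)}
    (hf : ∀ σ : Equiv.Perm (Fin N), subst (fun i => some (σ i)) f = f) :
    f ∈ (Submodule.span ℚ (Set.range SuperPartition.powerSum)).map (eval N).toLinearMap := by
  let R : SuperPoly (Fin N) →ₗ[ℚ] SuperPoly (Fin N) :=
    ∑ σ : Equiv.Perm (Fin N), (subst fun i => some (σ i)).toLinearMap
  have hR : ⊤ ≤ ((Submodule.span ℚ (Set.range SuperPartition.powerSum)).map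
      (eval N).toLinearMap).comap R := by
    rw [← span_range_word, Submodule.span_le]
    rintro _ ⟨c, rfl⟩
    have h : R (word c id) = augmentedMonomial N c := by
      rw [augmentedMonomial, ← (Equiv.embeddingEquivOfFinite (Fin N)).symm.sum_comp]
      simp only [R, LinearMap.sum_apply, AlgHom.toLinearMap_apply, subst_word]
      rfl
    have h' := augmentedMonomial_mem N c
    rw [← h] at h'
    exact h'
  have h1 := hR (Submodule.mem_top (x := f))
  have h2 : R f = (Fintype.card (Equiv.Perm (Fin N)) : ℚ) • f := by
    simp [R, LinearMap.sum_apply, hf, Nat.cast_smul_eq_nsmul]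
  rw [Submodule.mem_comap, h2] at h1
  exact (Submodule.smul_mem_iff _ (by simp [Nat.factorial_ne_zero, Fintype.card_perm])).1 h1

end SuperSym

/-! ### Bidegrees and the passage to the inverse limit. -/

namespace SuperPoly

/-- The projection onto the part of bidegree `(n|m)`. -/
def bihomogeneousPart (I : Type) (n m : ℕ) : SuperPoly I →ₗ[ℚ] SuperPoly I :=
  TensorProduct.map (MvPolynomial.homogeneousComponent n)
    (GradedAlgebra.proj (fun i : ℕ => ⋀[ℚ]^i (I →₀ ℚ)) m)

theorem bihomogeneousPart_of_mem {I : Type} {n m : ℕ} {a : SuperPoly I}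
    (ha : a ∈ bihomogeneous I n m) : bihomogeneousPart I n m a = a := by
  have h : bihomogeneous I n m ≤ LinearMap.eqLocus (bihomogeneousPart I n m) LinearMap.id := by
    refine Submodule.map₂_le.2 fun p hp w hw => ?_
    have hp' : MvPolynomial.homogeneousComponent n p = p :=
      (MvPolynomial.homogeneousComponent_of_mem hp).trans (if_pos rfl)
    simp [LinearMap.mem_eqLocus, bihomogeneousPart, GradedAlgebra.proj_apply, hp',
      DirectSum.decompose_of_mem_same (fun i : ℕ => ⋀[ℚ]^i (I →₀ ℚ)) hw]
  exact h ha

theorem bihomogeneousPart_of_mem_ne {I : Type} {n m n' m' : ℕ} (h : (n', m') ≠ (n, m))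
    {a : SuperPoly I} (ha : a ∈ bihomogeneous I n m) : bihomogeneousPart I n' m' a = 0 := by
  have h : bihomogeneous I n m ≤ LinearMap.ker (bihomogeneousPart I n' m') := by
    refine Submodule.map₂_le.2 fun p hp w hw => ?_
    by_cases hn : n' = n
    · have hm : m ≠ m' := fun hm => h (by rw [hn, hm])
      simp [LinearMap.mem_ker, bihomogeneousPart, GradedAlgebra.proj_apply,
        DirectSum.decompose_of_mem_ne (fun i : ℕ => ⋀[ℚ]^i (I →₀ ℚ)) hw hm]
    · have hp' : MvPolynomial.homogeneousComponent n' p = 0 :=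
        (MvPolynomial.homogeneousComponent_of_mem hp).trans (if_neg hn)
      simp [LinearMap.mem_ker, bihomogeneousPart, hp']
  exact h ha

end SuperPoly

namespace SuperPartition

/-- The superpartitions of bidegree `(n|m)`. -/
def ofBidegree (n m : ℕ) : Set SuperPartition :=
  {L | L.totalDegree = n ∧ L.fermionicDegree = m}

theorem finite_ofBidegree (n m : ℕ) : (ofBidegree n m).Finite := by
  classical
  -- A crude bound: a partition of size at most `n` has parts in `{1, …, n}`, each at most `n`
  -- times.
  set T : Multiset ℕ+ := n • (Multiset.range n).map Nat.succPNat with hT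
  refine (((Finset.range (n + 1)).powerset ×ˢ Finset.Icc 0 T).finite_toSet.image
    fun p => (⟨p.1, p.2⟩ : SuperPartition)).subset ?_
  rintro ⟨a, s⟩ ⟨hd, -⟩
  have hd' : ∑ k ∈ a, k + (s.map PNat.val).sum = n := hd
  refine ⟨(a, s), ?_, rfl⟩
  rw [Finset.mem_coe, Finset.mem_product, Finset.mem_powerset, Finset.mem_Icc]
  refine ⟨fun k hk => ?_, Multiset.zero_le _, Multiset.le_iff_count.2 fun r => ?_⟩
  · have := Finset.single_le_sum (s := a) (f := fun k => k) (fun _ _ => Nat.zero_le _) hk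
    rw [Finset.mem_range]
    omega
  · by_cases hr : r ∈ s
    · have h1 : (r : ℕ) ≤ (s.map PNat.val).sum :=
        Multiset.le_sum_of_mem (Multiset.mem_map_of_mem _ hr)
      have h2 : s.count r ≤ n := by
        have h3 : Multiset.card s ≤ (s.map PNat.val).sum := by
          rw [← Multiset.card_map PNat.val s]
          refine (Multiset.card_nsmul_le_sum (a := 1) fun x hx => ?_).trans' (by simp)
          obtain ⟨r, -, rfl⟩ := Multiset.mem_map.1 hx
          exact r.pos
        have := Multiset.count_le_card r s
        omega
      have h3 : 1 ≤ ((Multiset.range n).map Nat.succPNat).count r := by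
        rw [Multiset.one_le_count_iff_mem, Multiset.mem_map]
        refine ⟨r - 1, ?_, PNat.coe_injective ?_⟩
        · rw [Multiset.mem_range]
          have := r.pos
          omega
        · rw [Nat.succPNat_coe]
          exact Nat.succ_pred_eq_of_pos r.pos
      rw [hT, Multiset.count_nsmul]
      nlinarith
    · rw [Multiset.count_eq_zero_of_notMem hr]
      exact Nat.zero_le _

end SuperPartition

namespace SuperSym

/-- The kernels of the evaluations on `V` decrease with `N` and intersect in zero; in finite
dimension the chain stabilizes, so it reaches zero. -/
theorem exists_eval_injOn (V : Submodule ℚ SuperSym) [FiniteDimensional ℚ V] :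
    ∃ N₀, ∀ N ≥ N₀, ∀ f ∈ V, eval N f = 0 → f = 0 := by
  let κ : ℕ →o (Submodule ℚ V)ᵒᵈ :=
    ⟨fun N => OrderDual.toDual (LinearMap.ker ((eval N).toLinearMap ∘ₗ V.subtype)), by
      refine monotone_nat_of_le_succ fun N => OrderDual.toDual_le_toDual.2 fun f hf => ?_
      have hf' : eval (N + 1) f = 0 := hf
      change eval N f = 0
      rw [← subst_dropLast_eval, hf', map_zero]⟩
  obtain ⟨N₀, h⟩ := IsArtinian.monotone_stabilizes κ
  refine ⟨N₀, fun N hN f hf h0 => ext_eval fun N' => ?_⟩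
  have hmem : ∀ N, eval N f = 0 ↔ (⟨f, hf⟩ : V) ∈ OrderDual.ofDual (κ N) := fun N => Iff.rfl
  have h1 : eval (max N N') f = 0 := by
    rw [hmem, ← h _ (hN.trans (le_max_left _ _)), h N hN, ← hmem]
    exact h0
  rw [map_zero, hmem]
  exact κ.monotone (le_max_right N N') ((hmem _).1 h1)

/-- For each `N`, `f_N` comes from some element of the finite-dimensional `V`. Once evaluation is
injective on `V`, compatibility under dropping a variable forces these elements to coincide. -/
theorem bigraded_eq_span (n m : ℕ) :
    bigraded n m = Submodule.span ℚ (SuperPartition.powerSum '' SuperPartition.ofBidegree n m) := by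
  set V := Submodule.span ℚ (SuperPartition.powerSum '' SuperPartition.ofBidegree n m) with hV
  have hVb : V ≤ bigraded n m := by
    rw [hV, Submodule.span_le]
    rintro _ ⟨L, ⟨rfl, rfl⟩, rfl⟩
    exact L.powerSum_mem_bigraded
  have : FiniteDimensional ℚ V :=
    FiniteDimensional.span_of_finite ℚ ((SuperPartition.finite_ofBidegree n m).image _)
  obtain ⟨N₀, hN₀⟩ := exists_eval_injOn V
  refine le_antisymm (fun f hf => ?_) hVb
  have hex : ∀ N, ∃ g ∈ V, eval N g = eval N f := by
    intro N
    -- Projecting to bidegree `(n|m)` discards the `p_Λ` of other bidegrees from a representation of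
    -- `f_N`.
    have h1 : Submodule.span ℚ (Set.range SuperPartition.powerSum) ≤
        (V.map (eval N).toLinearMap).comap
          (bihomogeneousPart (Fin N) n m ∘ₗ (eval N).toLinearMap) := by
      rw [Submodule.span_le]
      rintro _ ⟨L, rfl⟩
      have hL := eval_mem L.powerSum_mem_bigraded N
      change bihomogeneousPart (Fin N) n m (eval N L.powerSum) ∈ V.map (eval N).toLinearMap
      by_cases h : (n, m) = (L.totalDegree, L.fermionicDegree)
      · obtain ⟨rfl, rfl⟩ := Prod.ext_iff.1 h
        rw [bihomogeneousPart_of_mem hL]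
        exact ⟨_, Submodule.subset_span ⟨L, ⟨rfl, rfl⟩, rfl⟩, rfl⟩
      · rw [bihomogeneousPart_of_mem_ne h hL]
        exact zero_mem _
    obtain ⟨g, hg, hgf⟩ := mem_map_eval_of_invariant (f := eval N f) (hf.2.1 N)
    obtain ⟨g', hg', h'⟩ := h1 hg
    refine ⟨g', hg', h'.trans ?_⟩
    rw [← bihomogeneousPart_of_mem (eval_mem hf N), ← hgf]
    rfl
  choose g hg hgf using hex
  have hstep : ∀ N ≥ N₀, g (N + 1) = g N := by
    intro N hN
    refine sub_eq_zero.1 (hN₀ N hN _ (sub_mem (hg _) (hg _)) ?_)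
    rw [map_sub, hgf, ← subst_dropLast_eval, hgf, subst_dropLast_eval, sub_self]
  have hconst : ∀ N ≥ N₀, g N = g N₀ := fun N hN =>
    Nat.le_induction rfl (fun N hN ih => (hstep N hN).trans ih) N hN
  -- The stable element must also be correct for `N < N₀`: agreement in `N + d` variables descends
  -- to `N` variables.
  have hlow : ∀ d N, eval N (g (N + d)) = eval N f := by
    intro d
    induction d with
    | zero => exact hgf
    | succ d ih =>
      intro N
      rw [← subst_dropLast_eval, ← subst_dropLast_eval N f, ← ih (N + 1), Nat.add_right_comm,
        Nat.add_assoc N d 1]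
  have : f = g N₀ := ext_eval fun N => by
    rw [← hlow N₀ N, hconst (N + N₀) (Nat.le_add_left _ _)]
  exact this ▸ hg N₀

theorem span_powerSum : Submodule.span ℚ (Set.range SuperPartition.powerSum) = ⊤ := by
  refine eq_top_iff.2 (iSup_bigraded.symm.le.trans (iSup_le fun p => ?_))
  rw [bigraded_eq_span]
  exact Submodule.span_mono (Set.image_subset_range _ _)

end SuperSym

/-! ### Functions of two alphabets -/

/-- A left inverse comes from the universal property: `v ↦ v_I ⊗ 1 + 1 ⊗ v_J` squares to zero in the
signed tensor product, because there the cross terms cancel. -/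
theorem ExteriorAlgebra.injective_mul_map_inl_inr (I J : Type) :
    Function.Injective (LinearMap.mul' ℚ (ExteriorAlgebra ℚ (I ⊕ J →₀ ℚ)) ∘ₗ
      TensorProduct.map (ExteriorAlgebra.map (Finsupp.linearCombination ℚ fun i => Finsupp.single (Sum.inl i) 1)).toLinearMap
        (ExteriorAlgebra.map (Finsupp.linearCombination ℚ fun j => Finsupp.single (Sum.inr j) 1)).toLinearMap) := by
  let 𝒜 := fun i : ℕ => ⋀[ℚ]^i (I →₀ ℚ)
  let ℬ := fun i : ℕ => ⋀[ℚ]^i (J →₀ ℚ)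
  let il : ExteriorAlgebra ℚ (I →₀ ℚ) →ₐ[ℚ] GradedTensorProduct ℚ 𝒜 ℬ :=
    GradedTensorProduct.includeLeft 𝒜 ℬ
  let ir : ExteriorAlgebra ℚ (J →₀ ℚ) →ₐ[ℚ] GradedTensorProduct ℚ 𝒜 ℬ :=
    GradedTensorProduct.includeRight 𝒜 ℬ
  have hι : ∀ {V : Type} [AddCommGroup V] [Module ℚ V] (v : V),
      ExteriorAlgebra.ι ℚ v ∈ ⋀[ℚ]^1 V := by
    intro V _ _ v
    rw [show ⋀[ℚ]^1 V = LinearMap.range (ExteriorAlgebra.ι ℚ) from pow_one _]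
    exact LinearMap.mem_range_self _ _
  let l : (I ⊕ J →₀ ℚ) →ₗ[ℚ] GradedTensorProduct ℚ 𝒜 ℬ :=
    il.toLinearMap ∘ₗ ExteriorAlgebra.ι ℚ ∘ₗ Finsupp.lcomapDomain Sum.inl Sum.inl_injective +
      ir.toLinearMap ∘ₗ ExteriorAlgebra.ι ℚ ∘ₗ Finsupp.lcomapDomain Sum.inr Sum.inr_injective
  have hl : ∀ v, l v * l v = 0 := by
    intro v
    have h1 : ∀ (v : I →₀ ℚ) (w : J →₀ ℚ), ir (ExteriorAlgebra.ι ℚ w) * il (ExteriorAlgebra.ι ℚ v) =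
        -(il (ExteriorAlgebra.ι ℚ v) * ir (ExteriorAlgebra.ι ℚ w)) := by
      intro v w
      have h2 := GradedTensorProduct.tmul_coe_mul_coe_tmul (R := ℚ) 𝒜 ℬ 1
        ⟨ExteriorAlgebra.ι ℚ w, hι w⟩ ⟨ExteriorAlgebra.ι ℚ v, hι v⟩ 1
      have h3 := GradedTensorProduct.tmul_one_mul_one_tmul (R := ℚ) 𝒜 ℬ
        (ExteriorAlgebra.ι ℚ v) (ExteriorAlgebra.ι ℚ w)
      simp only [one_mul, mul_one, uzpow_one] at h2
      refine h2.trans ?_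
      rw [← h3]
      simp
      rfl
    simp only [l, LinearMap.add_apply, LinearMap.comp_apply, AlgHom.toLinearMap_apply, add_mul,
      mul_add, h1, ← map_mul, ExteriorAlgebra.ι_sq_zero, map_zero]
    abel
  let Ψ := ExteriorAlgebra.lift ℚ ⟨l, hl⟩
  have hΨl : Ψ.comp (ExteriorAlgebra.map (Finsupp.linearCombination ℚ fun i => Finsupp.single (Sum.inl i) 1)) = il := by
    ext i
    simp [Ψ, l, Finsupp.lcomapDomain]
  have hΨr : Ψ.comp (ExteriorAlgebra.map (Finsupp.linearCombination ℚ fun j => Finsupp.single (Sum.inr j) 1)) = ir := by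
    ext i
    simp [Ψ, l, Finsupp.lcomapDomain]
  refine Function.LeftInverse.injective
    (g := (GradedTensorProduct.of ℚ 𝒜 ℬ).symm ∘ Ψ) fun t => ?_
  induction t using TensorProduct.induction_on with
  | zero => simp
  | tmul a b =>
    have ha := DFunLike.congr_fun hΨl a
    have hb := DFunLike.congr_fun hΨr b
    simp only [AlgHom.comp_apply] at ha hb
    simp only [LinearMap.comp_apply, TensorProduct.map_tmul, LinearMap.mul'_apply,
      AlgHom.toLinearMap_apply, Function.comp_apply, map_mul, ha, hb]
    exact congrArg _ (GradedTensorProduct.tmul_one_mul_one_tmul (R := ℚ) 𝒜 ℬ a b)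
  | add s t hs ht =>
    rw [map_add, Function.comp_apply, map_add, map_add]
    exact congrArg₂ _ hs ht

theorem MvPolynomial.injective_mul_rename_inl_inr (I J : Type) :
    Function.Injective (LinearMap.mul' ℚ (MvPolynomial (I ⊕ J) ℚ) ∘ₗ
      TensorProduct.map (aeval fun i => X (Sum.inl i)).toLinearMap
        (aeval fun j => X (Sum.inr j)).toLinearMap) := by
  let Ψ : MvPolynomial (I ⊕ J) ℚ →ₐ[ℚ] MvPolynomial I ℚ ⊗[ℚ] MvPolynomial J ℚ :=
    aeval (Sum.elim (fun i => X i ⊗ₜ 1) fun j => 1 ⊗ₜ X j)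
  have hΨl : Ψ.comp (aeval fun i => X (Sum.inl i)) = Algebra.TensorProduct.includeLeft := by
    ext i
    simp [Ψ]
  have hΨr : Ψ.comp (aeval fun j => X (Sum.inr j)) = Algebra.TensorProduct.includeRight := by
    ext i
    simp [Ψ]
  refine Function.LeftInverse.injective (g := Ψ) fun t => ?_
  induction t using TensorProduct.induction_on with
  | zero => simp
  | tmul a b =>
    have ha := DFunLike.congr_fun hΨl a
    have hb := DFunLike.congr_fun hΨr b
    simp only [AlgHom.comp_apply] at ha hb
    simp only [LinearMap.comp_apply, TensorProduct.map_tmul, LinearMap.mul'_apply,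
      AlgHom.toLinearMap_apply, map_mul, ha, hb]
    simp
  | add s t hs ht => rw [map_add, map_add, hs, ht]

/-- Polynomial and exterior factors commute, so reordering the four factors costs no sign and
presents the map as a tensor product of two injective maps over a field. -/
theorem SuperPoly.injective_mul_subst_inl_inr (I J : Type) :
    Function.Injective (LinearMap.mul' ℚ (SuperPoly (I ⊕ J)) ∘ₗ
      TensorProduct.map (subst fun i => some (Sum.inl i)).toLinearMap
        (subst fun j => some (Sum.inr j)).toLinearMap) := by
  have h := TensorProduct.map_injective_of_flat_flat _ _
    (MvPolynomial.injective_mul_rename_inl_inr I J) (ExteriorAlgebra.injective_mul_map_inl_inr I J)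
  have e : LinearMap.mul' ℚ (SuperPoly (I ⊕ J)) ∘ₗ
      TensorProduct.map (subst fun i => some (Sum.inl i)).toLinearMap
        (subst fun j => some (Sum.inr j)).toLinearMap = TensorProduct.map
      (LinearMap.mul' ℚ (MvPolynomial (I ⊕ J) ℚ) ∘ₗ
        TensorProduct.map (MvPolynomial.aeval fun i => MvPolynomial.X (Sum.inl i)).toLinearMap
          (MvPolynomial.aeval fun j => MvPolynomial.X (Sum.inr j)).toLinearMap)
      (LinearMap.mul' ℚ (ExteriorAlgebra ℚ (I ⊕ J →₀ ℚ)) ∘ₗ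
        TensorProduct.map (ExteriorAlgebra.map (Finsupp.linearCombination ℚ
          fun i => Finsupp.single (Sum.inl i) 1)).toLinearMap
        (ExteriorAlgebra.map (Finsupp.linearCombination ℚ
          fun j => Finsupp.single (Sum.inr j) 1)).toLinearMap) ∘ₗ
      (TensorProduct.tensorTensorTensorComm ℚ (MvPolynomial I ℚ) (ExteriorAlgebra ℚ (I →₀ ℚ))
        (MvPolynomial J ℚ) (ExteriorAlgebra ℚ (J →₀ ℚ))).toLinearMap := by
    refine TensorProduct.ext_fourfold' fun p v q w => ?_
    simp only [LinearMap.comp_apply, TensorProduct.map_tmul, LinearEquiv.coe_coe,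
      TensorProduct.tensorTensorTensorComm_tmul, LinearMap.mul'_apply]
    exact Algebra.TensorProduct.tmul_mul_tmul _ _ _ _
  rw [e]
  exact h.comp (LinearEquiv.injective _)

/-- In a basis of `U`, each coordinate of `t` is a vector of `V` killed by all the `g i`. No single
evaluation is injective on the whole ring, so a jointly separating family is needed. -/
theorem TensorProduct.eq_zero_of_forall_rTensor_eq_zero {K V U ι : Type*} {W : ι → Type*} [Field K]
    [AddCommGroup V] [Module K V] [AddCommGroup U] [Module K U] [∀ i, AddCommGroup (W i)]
    [∀ i, Module K (W i)] (g : ∀ i, V →ₗ[K] W i) (hg : ∀ v, (∀ i, g i v = 0) → v = 0)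
    {t : V ⊗[K] U} (ht : ∀ i, (g i).rTensor U t = 0) : t = 0 := by
  classical
  let b := Module.Basis.ofVectorSpace K U
  refine (TensorProduct.equivFinsuppOfBasisRight (M := V) b).injective (Finsupp.ext fun k => ?_)
  rw [map_zero, Finsupp.zero_apply]
  refine hg _ fun i => ?_
  have h : ∀ t : V ⊗[K] U, g i (TensorProduct.equivFinsuppOfBasisRight b t k) =
      TensorProduct.equivFinsuppOfBasisRight b ((g i).rTensor U t) k := by
    intro t
    induction t using TensorProduct.induction_on with
    | zero => simp
    | tmul v u => simp
    | add s t hs ht => simp [hs, ht]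
  rw [h, ht]
  simp

theorem TensorProduct.eq_zero_of_forall_map_eq_zero {K V V' ι ι' : Type*} {W : ι → Type*}
    {W' : ι' → Type*} [Field K] [AddCommGroup V] [Module K V] [AddCommGroup V'] [Module K V']
    [∀ i, AddCommGroup (W i)] [∀ i, Module K (W i)] [∀ i, AddCommGroup (W' i)]
    [∀ i, Module K (W' i)] (g : ∀ i, V →ₗ[K] W i) (hg : ∀ v, (∀ i, g i v = 0) → v = 0)
    (g' : ∀ i, V' →ₗ[K] W' i) (hg' : ∀ v, (∀ i, g' i v = 0) → v = 0)
    {t : V ⊗[K] V'} (ht : ∀ i j, TensorProduct.map (g i) (g' j) t = 0) : t = 0 := by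
  refine TensorProduct.eq_zero_of_forall_rTensor_eq_zero g hg fun i => ?_
  apply (TensorProduct.comm K (W i) V').injective
  rw [map_zero]
  refine TensorProduct.eq_zero_of_forall_rTensor_eq_zero g' hg' fun j => ?_
  have h : (g' j).rTensor (W i) ∘ₗ (TensorProduct.comm K (W i) V').toLinearMap ∘ₗ
      (g i).rTensor V' =
      (TensorProduct.comm K (W i) (W' j)).toLinearMap ∘ₗ TensorProduct.map (g i) (g' j) :=
    TensorProduct.ext' fun v v' => rfl
  have h' := LinearMap.congr_fun h t
  rw [LinearMap.comp_apply, LinearMap.comp_apply, LinearMap.comp_apply, ht, map_zero] at h'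
  exact h'

namespace SuperSym

theorem injective_evalTensor : Function.Injective evalTensor := by
  refine (injective_iff_map_eq_zero _).2 fun t ht => ?_
  refine TensorProduct.eq_zero_of_forall_map_eq_zero (fun N => (eval N).toLinearMap)
    (fun f hf => ext_eval fun N => (hf N).trans (map_zero _).symm)
    (fun N => (eval N).toLinearMap)
    (fun f hf => ext_eval fun N => (hf N).trans (map_zero _).symm) (t := t) fun N M => ?_
  apply injective_mul_subst_inl_inr
  rw [map_zero, ← LinearMap.comp_apply, LinearMap.comp_assoc, ← TensorProduct.map_comp]
  exact congrFun (congrFun ht N) M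

end SuperSym

/-! ### The basis of power sum products and diagonal operators -/

namespace SuperSym

/-- The basis of the `p_Λ`. -/
def basis : Module.Basis SuperPartition ℚ SuperSym :=
  Module.Basis.mk SuperPartition.linearIndependent_powerSum span_powerSum.ge

@[simp]
theorem basis_apply (L : SuperPartition) : basis L = L.powerSum := by simp [basis]

theorem induction {P : SuperSym → Prop} (one : P 1) (gen_mul : ∀ q f, P f → P (gen q * f))
    (add : ∀ f g, P f → P g → P (f + g)) (smul : ∀ (c : ℚ) f, P f → P (c • f)) (f : SuperSym) :
    P f := by
  have h : ∀ L : SuperPartition, P L.powerSum := by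
    intro L
    induction L using SuperPartition.induction with
    | h0 => rwa [SuperPartition.powerSum_empty]
    | h1 r L ih => rw [← SuperPartition.powerSum_mul_powerSum]; exact gen_mul (.inl r) _ ih
    | h2 k L hk ih =>
      obtain ⟨ε, hε, h⟩ := SuperPartition.oddPowerSum_mul_powerSum hk
      have := smul ε _ (gen_mul (.inr k) _ ih)
      rwa [gen, Sum.elim_inr, h, smul_smul, hε, one_smul] at this
  have hf : f ∈ Submodule.span ℚ (Set.range SuperPartition.powerSum) := by
    rw [span_powerSum]; trivial
  induction hf using Submodule.span_induction with
  | mem _ h' => obtain ⟨L, rfl⟩ := h'; exact h L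
  | zero => simpa using smul 0 1 one
  | add f g _ _ hf hg => exact add f g hf hg
  | smul c f _ hf => exact smul c f hf

/-- The device behind the Hopf axioms: two maps agree if they agree at 1 and obey the same rule for
left multiplication by a generator. -/
theorem hom_ext {M : Type*} [AddCommGroup M] [Module ℚ M] {φ ψ : SuperSym →ₗ[ℚ] M}
    (one : φ 1 = ψ 1) (gen_mul : ∀ q f, φ f = ψ f → φ (gen q * f) = ψ (gen q * f)) : φ = ψ :=
  LinearMap.ext fun f => induction (P := fun f => φ f = ψ f) one gen_mul
    (fun f g hf hg => by rw [map_add, map_add, hf, hg])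
    (fun c f hf => by rw [map_smul, map_smul, hf]) f

/-- The operator that is diagonal in the basis of the `p_Λ`. -/
def diag (c : SuperPartition → ℚ) : SuperSym →ₗ[ℚ] SuperSym :=
  basis.constr ℚ fun L => c L • L.powerSum

@[simp]
theorem diag_powerSum (c : SuperPartition → ℚ) (L : SuperPartition) :
    diag c L.powerSum = c L • L.powerSum := by
  rw [← basis_apply, diag, Module.Basis.constr_basis, basis_apply]

/-- Two linear maps agreeing on the `p_Λ` are equal. -/
theorem hom_ext_powerSum {M : Type*} [AddCommGroup M] [Module ℚ M] {φ ψ : SuperSym →ₗ[ℚ] M}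
    (h : ∀ L : SuperPartition, φ L.powerSum = ψ L.powerSum) : φ = ψ :=
  basis.ext fun L => by simpa using h L

/-- Two linear maps agreeing on the `p_Λ ⊗ p_Ω` are equal. -/
theorem tensor_hom_ext {M : Type*} [AddCommGroup M] [Module ℚ M]
    {φ ψ : SuperSym ⊗[ℚ] SuperSym →ₗ[ℚ] M}
    (h : ∀ L L' : SuperPartition, φ (L.powerSum ⊗ₜ L'.powerSum) = ψ (L.powerSum ⊗ₜ L'.powerSum)) :
    φ = ψ :=
  (basis.tensorProduct basis).ext fun L => by
    simpa [Module.Basis.tensorProduct_apply'] using h L.1 L.2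


/-- An eigenvalue that is multiplicative in the parts makes the operator commute with generators up
to a scalar. A repeated odd part gives zero on both sides. This covers both `twist` and `antipode`.
-/
theorem diag_gen_mul {c : SuperPartition → ℚ} {e : ℕ+ ⊕ ℕ → ℚ}
    (h1 : ∀ r L, c (L.addEven r) = e (.inl r) * c L)
    (h2 : ∀ k L, k ∉ L.a → c (L.addOdd k) = e (.inr k) * c L) (q : ℕ+ ⊕ ℕ) (f : SuperSym) :
    diag c (gen q * f) = e q • (gen q * diag c f) := by
  have h : diag c ∘ₗ LinearMap.mulLeft ℚ (gen q) =
      e q • LinearMap.mulLeft ℚ (gen q) ∘ₗ diag c := by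
    refine hom_ext_powerSum fun L => ?_
    cases q with
    | inl r =>
      simp [gen, SuperPartition.powerSum_mul_powerSum, h1, mul_smul]
    | inr k =>
      by_cases hk : k ∈ L.a
      · simp [gen, SuperPartition.oddPowerSum_mul_powerSum_of_mem hk]
      · obtain ⟨ε, -, h⟩ := SuperPartition.oddPowerSum_mul_powerSum hk
        simp [gen, h, h2 k L hk, mul_smul, smul_comm ε]
  exact LinearMap.congr_fun h f

theorem span_comap_gen_mul {D : SuperPartition → ℕ} {d : ℕ+ ⊕ ℕ → ℕ}
    (h1 : ∀ r L, D (L.addEven r) = d (.inl r) + D L)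
    (h2 : ∀ k L, k ∉ L.a → D (L.addOdd k) = d (.inr k) + D L) (q : ℕ+ ⊕ ℕ) (n : ℕ) {f : SuperSym}
    (hf : f ∈ Submodule.span ℚ (SuperPartition.powerSum '' {L | D L = n})) :
    gen q * f ∈ Submodule.span ℚ (SuperPartition.powerSum '' {L | D L = d q + n}) := by
  suffices h : Submodule.span ℚ (SuperPartition.powerSum '' {L | D L = n}) ≤
      (Submodule.span ℚ (SuperPartition.powerSum '' {L | D L = d q + n})).comap
        (LinearMap.mulLeft ℚ (gen q)) from h hf
  rw [Submodule.span_le]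
  rintro _ ⟨L, rfl, rfl⟩
  rw [SetLike.mem_coe, Submodule.mem_comap, LinearMap.mulLeft_apply]
  cases q with
  | inl r =>
    exact Submodule.subset_span ⟨L.addEven r, h1 r L, (L.powerSum_mul_powerSum r).symm⟩
  | inr k =>
    by_cases hk : k ∈ L.a
    · rw [gen, Sum.elim_inr, SuperPartition.oddPowerSum_mul_powerSum_of_mem hk]
      exact zero_mem _
    · obtain ⟨ε, -, h⟩ := SuperPartition.oddPowerSum_mul_powerSum hk
      rw [gen, Sum.elim_inr, h]
      exact Submodule.smul_mem _ _ (Submodule.subset_span ⟨L.addOdd k, h2 k L hk, rfl⟩)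

theorem diag_mem_span (c : SuperPartition → ℚ) (s : Set SuperPartition) {f : SuperSym}
    (hf : f ∈ Submodule.span ℚ (SuperPartition.powerSum '' s)) :
    diag c f ∈ Submodule.span ℚ (SuperPartition.powerSum '' s) := by
  suffices h : Submodule.span ℚ (SuperPartition.powerSum '' s) ≤
      (Submodule.span ℚ (SuperPartition.powerSum '' s)).comap (diag c) from h hf
  rw [Submodule.span_le]
  rintro _ ⟨L, hL, rfl⟩
  rw [SetLike.mem_coe, Submodule.mem_comap, diag_powerSum]
  exact Submodule.smul_mem _ _ (Submodule.subset_span ⟨L, hL, rfl⟩)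

theorem fermionic_eq_span (m : ℕ) :
    fermionic m = Submodule.span ℚ (SuperPartition.powerSum '' {L | L.fermionicDegree = m}) := by
  refine le_antisymm (iSup_le fun n => ?_) (Submodule.span_le.2 ?_)
  · rw [bigraded_eq_span]
    exact Submodule.span_mono (Set.image_mono fun L hL => hL.2)
  · rintro _ ⟨L, rfl, rfl⟩
    exact bigraded_le_fermionic _ _ L.powerSum_mem_bigraded

theorem bigraded_le_simpleDegree (n m : ℕ) : bigraded n m ≤ simpleDegree (n + m) :=
  le_iSup₂_of_le (f := fun (p : ℕ × ℕ) (_ : p.1 + p.2 = n + m) => bigraded p.1 p.2) (n, m) rfl le_rfl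

theorem simpleDegree_eq_span (k : ℕ) : simpleDegree k = Submodule.span ℚ
    (SuperPartition.powerSum '' {L | L.totalDegree + L.fermionicDegree = k}) := by
  refine le_antisymm (iSup₂_le fun p hp => ?_) (Submodule.span_le.2 ?_)
  · rw [bigraded_eq_span]
    refine Submodule.span_mono (Set.image_mono fun L hL => ?_)
    rw [Set.mem_ofPred_eq, hL.1, hL.2, hp]
  · rintro _ ⟨L, rfl, rfl⟩
    exact bigraded_le_simpleDegree _ _ L.powerSum_mem_bigraded

theorem powerSum_mem_fermionic (L : SuperPartition) :
    L.powerSum ∈ fermionic L.fermionicDegree :=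
  bigraded_le_fermionic _ _ L.powerSum_mem_bigraded

theorem diag_of_mem_fermionic (c : ℕ → ℚ) {m : ℕ} {f : SuperSym} (hf : f ∈ fermionic m) :
    diag (fun L => c L.fermionicDegree) f = c m • f := by
  suffices h : fermionic m ≤ LinearMap.eqLocus (diag fun L => c L.fermionicDegree)
      (c m • LinearMap.id) from h hf
  rw [fermionic_eq_span, Submodule.span_le]
  rintro _ ⟨L, rfl, rfl⟩
  simp [LinearMap.mem_eqLocus]

/-- Any function on the index set of a basis splits the space into the spans of its fibres. -/
theorem isInternal_span_image {D : SuperPartition → ℕ} :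
    DirectSum.IsInternal fun n => Submodule.span ℚ (SuperPartition.powerSum '' {L | D L = n}) := by
  refine (DirectSum.isInternal_submodule_iff_iSupIndep_and_iSup_eq_top _).2 ⟨fun n => ?_, ?_⟩
  · refine (SuperPartition.linearIndependent_powerSum.disjoint_span_image
      (s := {L | D L = n}) (t := {L | D L ≠ n}) ?_).mono_right (iSup₂_le fun j hj => ?_)
    · exact Set.disjoint_left.2 fun L h h' => h' h
    · exact Submodule.span_mono (Set.image_mono fun L hL h => hj (hL.symm.trans h))
  · refine eq_top_iff.2 (span_powerSum.ge.trans (Submodule.span_le.2 ?_))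
    rintro _ ⟨L, rfl⟩
    exact (le_iSup (fun n => Submodule.span ℚ (SuperPartition.powerSum '' {L | D L = n})) (D L))
      (Submodule.subset_span ⟨L, rfl, rfl⟩)

/-- The sign operator `f ↦ (-1) ^ (deg q * deg f) f`. -/
def twist (q : ℕ+ ⊕ ℕ) : SuperSym →ₗ[ℚ] SuperSym :=
  diag fun L => (-1) ^ (parity q * L.fermionicDegree)

theorem twist_of_mem_fermionic (q : ℕ+ ⊕ ℕ) {m : ℕ} {f : SuperSym} (hf : f ∈ fermionic m) :
    twist q f = (-1 : ℚ) ^ (parity q * m) • f :=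
  diag_of_mem_fermionic (fun m => (-1) ^ (parity q * m)) hf

theorem _root_.SuperPartition.fermionicDegree_addOdd {k : ℕ} {L : SuperPartition} (hk : k ∉ L.a) :
    (L.addOdd k).fermionicDegree = 1 + L.fermionicDegree := by
  simp [SuperPartition.fermionicDegree, SuperPartition.addOdd, hk, add_comm]

theorem twist_gen_mul (q q' : ℕ+ ⊕ ℕ) (f : SuperSym) :
    twist q (gen q' * f) = (-1 : ℚ) ^ (parity q * parity q') • (gen q' * twist q f) := by
  refine diag_gen_mul (e := fun q' => (-1 : ℚ) ^ (parity q * parity q')) (fun r L => ?_)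
    (fun k L hk => ?_) q' f
  · simp [SuperPartition.addEven, SuperPartition.fermionicDegree, parity]
  · simp [SuperPartition.fermionicDegree_addOdd hk, parity, mul_add, pow_add]

theorem twist_one (q : ℕ+ ⊕ ℕ) : twist q 1 = 1 := by
  rw [← SuperPartition.powerSum_empty, twist, diag_powerSum]
  simp [SuperPartition.empty, SuperPartition.fermionicDegree]

theorem twist_mul_gen (q : ℕ+ ⊕ ℕ) (f : SuperSym) : twist q f * gen q = gen q * f := by
  have h : LinearMap.mulRight ℚ (gen q) ∘ₗ twist q = LinearMap.mulLeft ℚ (gen q) := by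
    refine hom_ext_powerSum fun L => ?_
    simp only [LinearMap.comp_apply, LinearMap.mulRight_apply, LinearMap.mulLeft_apply,
      twist_of_mem_fermionic q (powerSum_mem_fermionic L), smul_mul_assoc]
    exact (mul_eq_neg_one_pow_smul_mul (gen_mem_fermionic q) (powerSum_mem_fermionic L)).symm
  exact LinearMap.congr_fun h f

/-! ### The counit and the antipode -/

/-- The constant term. -/
def counit : SuperSym →ₗ[ℚ] ℚ := basis.coord SuperPartition.empty

theorem counit_powerSum (L : SuperPartition) :
    counit L.powerSum = if L = SuperPartition.empty then 1 else 0 := by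
  rw [← basis_apply, counit, Module.Basis.coord_apply, Module.Basis.repr_self,
    Finsupp.single_apply]

@[simp]
theorem counit_one : counit 1 = 1 := by
  rw [← SuperPartition.powerSum_empty, counit_powerSum, if_pos rfl]

@[simp]
theorem counit_gen_mul (q : ℕ+ ⊕ ℕ) (f : SuperSym) : counit (gen q * f) = 0 := by
  have h : counit ∘ₗ LinearMap.mulLeft ℚ (gen q) = 0 := by
    refine hom_ext_powerSum fun L => ?_
    cases q with
    | inl r =>
      simp [gen, SuperPartition.powerSum_mul_powerSum, counit_powerSum, SuperPartition.addEven,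
        SuperPartition.empty]
    | inr k =>
      by_cases hk : k ∈ L.a
      · simp [gen, SuperPartition.oddPowerSum_mul_powerSum_of_mem hk]
      · obtain ⟨ε, -, h⟩ := SuperPartition.oddPowerSum_mul_powerSum hk
        simp [gen, h, counit_powerSum, SuperPartition.addOdd, SuperPartition.empty]
  exact LinearMap.congr_fun h f

@[simp]
theorem counit_gen (q : ℕ+ ⊕ ℕ) : counit (gen q) = 0 := by
  simpa using counit_gen_mul q 1

@[simp]
theorem counit_twist (q : ℕ+ ⊕ ℕ) (f : SuperSym) : counit (twist q f) = counit f := by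
  have h : counit ∘ₗ twist q = counit :=
    hom_ext (by simp [twist_one]) fun q' f _ => by simp [twist_gen_mul]
  exact LinearMap.congr_fun h f

theorem counit_mul (f g : SuperSym) : counit (f * g) = counit f * counit g := by
  induction f using SuperSym.induction with
  | one => simp
  | gen_mul q f _ => simp [mul_assoc]
  | add f f' hf hf' => rw [add_mul, map_add, map_add, hf, hf', add_mul]
  | smul c f hf => simp [hf, mul_assoc]

/-- The antipode, `p_Λ ↦ (-1) ^ ℓ(Λ) p_Λ`. -/
def antipode : SuperSym →ₗ[ℚ] SuperSym := diag fun L => (-1) ^ L.length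

theorem antipode_gen_mul (q : ℕ+ ⊕ ℕ) (f : SuperSym) :
    antipode (gen q * f) = -(gen q * antipode f) := by
  rw [antipode, diag_gen_mul (e := fun _ => -1), neg_smul, one_smul]
  · intro r L
    rw [SuperPartition.length_addEven, pow_succ']
  · intro k L hk
    rw [SuperPartition.length_addOdd hk, pow_succ']

theorem antipode_one : antipode 1 = 1 := by
  rw [← SuperPartition.powerSum_empty, antipode, diag_powerSum]
  simp [SuperPartition.empty, SuperPartition.length]

theorem diag_comm (c d : SuperPartition → ℚ) (f : SuperSym) : diag c (diag d f) = diag d (diag c f) := by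
  have h : diag c ∘ₗ diag d = diag d ∘ₗ diag c :=
    hom_ext_powerSum fun L => by simp [smul_smul, mul_comm]
  exact LinearMap.congr_fun h f

end SuperSym

/-! ### The coproduct -/

theorem SuperPoly.subst_mem_bihomogeneous {I J : Type} (g : I → J) {n m : ℕ} {a : SuperPoly I}
    (ha : a ∈ bihomogeneous I n m) : subst (fun i => some (g i)) a ∈ bihomogeneous J n m := by
  suffices h : bihomogeneous I n m ≤
      (bihomogeneous J n m).comap (subst fun i => some (g i)).toLinearMap from h ha
  refine Submodule.map₂_le.2 fun p hp w hw => ?_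
  refine Submodule.apply_mem_map₂ (TensorProduct.mk ℚ (MvPolynomial J ℚ)
    (ExteriorAlgebra ℚ (J →₀ ℚ))) ?_ ?_
  · have := MvPolynomial.IsHomogeneous.aeval (φ := p) hp
      (fun i => (some (g i)).elim (0 : MvPolynomial J ℚ) MvPolynomial.X) (n := 1)
      fun i => MvPolynomial.isHomogeneous_X ℚ (g i)
    rwa [one_mul] at this
  · set f := Finsupp.linearCombination ℚ fun i => (some (g i)).elim (0 : J →₀ ℚ)
      fun j => Finsupp.single j 1
    have h : (⋀[ℚ]^m (I →₀ ℚ)).map (ExteriorAlgebra.map f).toLinearMap ≤ ⋀[ℚ]^m (J →₀ ℚ) := by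
      rw [Submodule.map_pow, ExteriorAlgebra.ι_range_map_map]
      exact pow_le_pow_left' LinearMap.map_le_range m
    exact h (Submodule.mem_map_of_mem hw)

theorem neg_one_units_pow_smul {V : Type*} [AddCommGroup V] [Module ℚ V] (n : ℕ) (v : V) :
    (-1 : ℤˣ) ^ n • v = (-1 : ℚ) ^ n • v := by
  rcases Nat.even_or_odd n with h | h <;> simp [h.neg_one_pow, Units.smul_def]

namespace SuperSym

/-- The sign rule between two alphabets, which is the condition for a morphism out of the signed
tensor product. -/
theorem subst_eval_mul_subst_eval {I : Type} {N M : ℕ} (g : Fin N → I) (h : Fin M → I) {i j : ℕ}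
    {a b : SuperSym} (ha : a ∈ fermionic i) (hb : b ∈ fermionic j) :
    subst (fun k => some (g k)) (eval N a) * subst (fun k => some (h k)) (eval M b) =
      (-1 : ℚ) ^ (i * j) •
        (subst (fun k => some (h k)) (eval M b) * subst (fun k => some (g k)) (eval N a)) := by
  let φ : SuperSym →ₗ[ℚ] SuperPoly I := ((subst fun k => some (g k)).comp (eval N)).toLinearMap
  let ψ : SuperSym →ₗ[ℚ] SuperPoly I := ((subst fun k => some (h k)).comp (eval M)).toLinearMap
  suffices h : fermionic i ≤ LinearMap.eqLocus (LinearMap.mulRight ℚ (ψ b) ∘ₗ φ)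
      ((-1 : ℚ) ^ (i * j) • LinearMap.mulLeft ℚ (ψ b) ∘ₗ φ) from h ha
  refine iSup_le fun n a ha => ?_
  suffices h : fermionic j ≤ LinearMap.eqLocus (LinearMap.mulLeft ℚ (φ a) ∘ₗ ψ)
      ((-1 : ℚ) ^ (i * j) • LinearMap.mulRight ℚ (φ a) ∘ₗ ψ) from h hb
  exact iSup_le fun n' b hb => SuperPoly.mul_eq_neg_one_pow_smul_mul
    (subst_mem_bihomogeneous g (eval_mem ha N)) (subst_mem_bihomogeneous h (eval_mem hb M))

/-- The graded tensor product of two copies of the ring of symmetric functions in superspace. -/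
abbrev GradedTensor : Type := GradedTensorProduct ℚ fermionic fermionic

/-- The map `f ⊗ g ↦ f(x; θ) g(y; φ)` as an algebra morphism. -/
def evalTensorHom : GradedTensor →ₐ[ℚ] ((N M : ℕ) → SuperPoly (Fin N ⊕ Fin M)) :=
  GradedTensorProduct.lift fermionic fermionic
    (AlgHom.pi fun N => AlgHom.pi fun M =>
      (subst fun i : Fin N => some (Sum.inl i : Fin N ⊕ Fin M)).comp (eval N))
    (AlgHom.pi fun N => AlgHom.pi fun M =>
      (subst fun j : Fin M => some (Sum.inr j : Fin N ⊕ Fin M)).comp (eval M))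
    fun i j a b => by
      refine Eq.trans ?_ (neg_one_units_pow_smul (j * i) _).symm
      funext N M
      have h := subst_eval_mul_subst_eval (I := Fin N ⊕ Fin M) Sum.inl Sum.inr a.2 b.2
      rw [mul_comm i j] at h
      exact h

theorem evalTensorHom_of (t : SuperSym ⊗[ℚ] SuperSym) :
    evalTensorHom (GradedTensorProduct.of ℚ fermionic fermionic t) = evalTensor t := by
  induction t using TensorProduct.induction_on with
  | zero => simp
  | tmul f g => exact GradedTensorProduct.lift_tmul fermionic fermionic _ _ _ f g
  | add s t hs ht => rw [map_add, map_add, map_add, hs, ht]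

theorem injective_evalTensorHom : Function.Injective evalTensorHom := by
  intro s t h
  have h' := injective_evalTensor (a₁ := (GradedTensorProduct.of ℚ fermionic fermionic).symm s)
    (a₂ := (GradedTensorProduct.of ℚ fermionic fermionic).symm t)
  rw [← evalTensorHom_of, ← evalTensorHom_of] at h'
  exact (GradedTensorProduct.of ℚ fermionic fermionic).symm.injective (h' (by simpa using h))

/-- The map `f ↦ f(x, y; θ, φ)` as an algebra morphism. -/
def evalUnionHom : SuperSym →ₐ[ℚ] ((N M : ℕ) → SuperPoly (Fin N ⊕ Fin M)) :=
  AlgHom.pi fun N => AlgHom.pi fun M =>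
    (subst fun i => some (finSumFinEquiv.symm i)).comp (eval (N + M))

theorem evalUnionHom_apply (f : SuperSym) (N M : ℕ) : evalUnionHom f N M = evalUnion f N M := rfl

/-- The coproduct `q ⊗ 1 + 1 ⊗ q` of a power sum. -/
def comulGen (q : ℕ+ ⊕ ℕ) : GradedTensor :=
  GradedTensorProduct.of ℚ fermionic fermionic (gen q ⊗ₜ 1 + 1 ⊗ₜ gen q)

theorem evalTensorHom_comulGen (q : ℕ+ ⊕ ℕ) :
    evalTensorHom (comulGen q) = evalUnionHom (gen q) := by
  rw [comulGen, evalTensorHom_of]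
  funext N M
  rw [map_add, Pi.add_apply, Pi.add_apply, evalTensor_tmul, evalTensor_tmul, evalUnionHom_apply,
    evalUnion]
  simp only [← eval_apply, map_one, mul_one, one_mul]
  cases q with
  | inl r =>
    simp only [gen, Sum.elim_inl, eval_powerSum, map_sum, map_pow, subst_x, Option.elim_some]
    rw [← finSumFinEquiv.sum_comp, Fintype.sum_sum_type]
    simp
  | inr k =>
    simp only [gen, Sum.elim_inr, eval_oddPowerSum, map_sum, map_mul, map_pow, subst_x, subst_θ,
      Option.elim_some]
    rw [← finSumFinEquiv.sum_comp, Fintype.sum_sum_type]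
    simp

/-- The range is a subalgebra, and `q(x, y) = q(x) + q(y)` puts every generator in it. -/
theorem evalUnionHom_mem_range (f : SuperSym) : evalUnionHom f ∈ evalTensorHom.range := by
  induction f using SuperSym.induction with
  | one => exact ⟨1, by simp⟩
  | gen_mul q f hf =>
    rw [map_mul]
    exact mul_mem ⟨_, evalTensorHom_comulGen q⟩ hf
  | add f g hf hg => rw [map_add]; exact add_mem hf hg
  | smul c f hf => rw [map_smul]; exact Subalgebra.smul_mem _ hf c

/-- The coproduct, as an algebra morphism to the graded tensor product. -/
def comulHom : SuperSym →ₐ[ℚ] GradedTensor :=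
  (AlgEquiv.ofInjective evalTensorHom injective_evalTensorHom).symm.toAlgHom.comp
    (evalUnionHom.codRestrict evalTensorHom.range evalUnionHom_mem_range)

theorem evalTensorHom_comulHom (f : SuperSym) : evalTensorHom (comulHom f) = evalUnionHom f := by
  have h := AlgEquiv.apply_symm_apply (AlgEquiv.ofInjective evalTensorHom injective_evalTensorHom)
    (evalUnionHom.codRestrict evalTensorHom.range evalUnionHom_mem_range f)
  exact congrArg Subtype.val h

theorem comulHom_gen (q : ℕ+ ⊕ ℕ) : comulHom (gen q) = comulGen q :=
  injective_evalTensorHom (by rw [evalTensorHom_comulHom, evalTensorHom_comulGen])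

/-- The coproduct. -/
def comul : SuperSym →ₗ[ℚ] SuperSym ⊗[ℚ] SuperSym :=
  (GradedTensorProduct.of ℚ fermionic fermionic).symm.toLinearMap ∘ₗ comulHom.toLinearMap

theorem of_comul (f : SuperSym) :
    GradedTensorProduct.of ℚ fermionic fermionic (comul f) = comulHom f := rfl

theorem evalTensor_comul (f : SuperSym) : evalTensor (comul f) = evalUnionHom f := by
  rw [← evalTensorHom_of, of_comul, evalTensorHom_comulHom]

theorem comul_one : comul 1 = 1 ⊗ₜ 1 := by
  change (GradedTensorProduct.of ℚ fermionic fermionic).symm (comulHom 1) = _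
  rw [map_one]
  rfl

/-- Left multiplication by `q ⊗ 1 + 1 ⊗ q`. -/
def primitiveMul (q : ℕ+ ⊕ ℕ) : SuperSym ⊗[ℚ] SuperSym →ₗ[ℚ] SuperSym ⊗[ℚ] SuperSym :=
  (LinearMap.mulLeft ℚ (gen q)).rTensor SuperSym +
    TensorProduct.map (twist q) (LinearMap.mulLeft ℚ (gen q))

theorem primitiveMul_tmul (q : ℕ+ ⊕ ℕ) (a b : SuperSym) :
    primitiveMul q (a ⊗ₜ b) = (gen q * a) ⊗ₜ b + twist q a ⊗ₜ (gen q * b) := rfl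

theorem of_primitiveMul (q : ℕ+ ⊕ ℕ) (t : SuperSym ⊗[ℚ] SuperSym) :
    GradedTensorProduct.of ℚ fermionic fermionic (primitiveMul q t) =
      comulGen q * GradedTensorProduct.of ℚ fermionic fermionic t := by
  suffices h : (GradedTensorProduct.of ℚ fermionic fermionic).toLinearMap ∘ₗ primitiveMul q =
      LinearMap.mulLeft ℚ (comulGen q) ∘ₗ
        (GradedTensorProduct.of ℚ fermionic fermionic).toLinearMap from LinearMap.congr_fun h t
  refine tensor_hom_ext fun L L' => ?_
  have h1 := GradedTensorProduct.tmul_one_mul_coe_tmul (R := ℚ) fermionic fermionic (gen q)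
    ⟨_, powerSum_mem_fermionic L⟩ L'.powerSum
  have h2 := GradedTensorProduct.tmul_coe_mul_coe_tmul (R := ℚ) fermionic fermionic 1
    ⟨_, gen_mem_fermionic q⟩ ⟨_, powerSum_mem_fermionic L⟩ L'.powerSum
  simp only [LinearMap.comp_apply, LinearMap.mulLeft_apply, LinearEquiv.coe_coe, comulGen,
    primitiveMul_tmul, map_add, add_mul]
  refine congrArg₂ _ h1.symm (Eq.trans ?_ h2.symm)
  rw [twist_of_mem_fermionic q (powerSum_mem_fermionic L), ← TensorProduct.smul_tmul', map_smul]
  refine Eq.trans ?_ (neg_one_units_pow_smul (parity q * L.fermionicDegree) _).symm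
  rw [one_mul]

/-- Primitivity in the form used below: on the plain tensor product, the signed product by `1 ⊗ q`
becomes multiplication on the right factor and `twist q` on the left one. -/
theorem comul_gen_mul (q : ℕ+ ⊕ ℕ) (f : SuperSym) :
    comul (gen q * f) = primitiveMul q (comul f) := by
  apply (GradedTensorProduct.of ℚ fermionic fermionic).injective
  rw [of_primitiveMul, of_comul, of_comul, map_mul, comulHom_gen]

theorem comul_twist (q : ℕ+ ⊕ ℕ) (f : SuperSym) :
    comul (twist q f) = TensorProduct.map (twist q) (twist q) (comul f) := by
  suffices h : comul ∘ₗ twist q = TensorProduct.map (twist q) (twist q) ∘ₗ comul from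
    LinearMap.congr_fun h f
  have key : ∀ (q' : ℕ+ ⊕ ℕ) (t : SuperSym ⊗[ℚ] SuperSym),
      TensorProduct.map (twist q) (twist q) (primitiveMul q' t) =
      (-1 : ℚ) ^ (parity q * parity q') •
        primitiveMul q' (TensorProduct.map (twist q) (twist q) t) := by
    intro q' t
    induction t using TensorProduct.induction_on with
    | zero => simp
    | tmul a b =>
      simp only [primitiveMul_tmul, map_add, TensorProduct.map_tmul, twist_gen_mul,
        TensorProduct.tmul_smul, smul_add, TensorProduct.smul_tmul']
      rw [show twist q (twist q' a) = twist q' (twist q a) from diag_comm _ _ _]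
    | add s t hs ht => rw [map_add, map_add, hs, ht, map_add, map_add, smul_add]
  refine hom_ext ?_ fun q' f hf => ?_
  · simp [twist_one, comul_one]
  · rw [LinearMap.comp_apply, LinearMap.comp_apply] at hf ⊢
    rw [twist_gen_mul, map_smul, comul_gen_mul, hf, comul_gen_mul, key]

/-- Left multiplication by `q ⊗ 1 ⊗ 1 + 1 ⊗ q ⊗ 1 + 1 ⊗ 1 ⊗ q`. -/
def primitiveMul₃ (q : ℕ+ ⊕ ℕ) :
    SuperSym ⊗[ℚ] (SuperSym ⊗[ℚ] SuperSym) →ₗ[ℚ] SuperSym ⊗[ℚ] (SuperSym ⊗[ℚ] SuperSym) :=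
  (LinearMap.mulLeft ℚ (gen q)).rTensor (SuperSym ⊗[ℚ] SuperSym) +
    TensorProduct.map (twist q) (primitiveMul q)

theorem primitiveMul₃_tmul (q : ℕ+ ⊕ ℕ) (a : SuperSym) (t : SuperSym ⊗[ℚ] SuperSym) :
    primitiveMul₃ q (a ⊗ₜ t) = (gen q * a) ⊗ₜ t + twist q a ⊗ₜ primitiveMul q t := rfl

theorem comul_coassoc :
    (TensorProduct.assoc ℚ SuperSym SuperSym SuperSym).toLinearMap ∘ₗ comul.rTensor SuperSym ∘ₗ
      comul = comul.lTensor SuperSym ∘ₗ comul := by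
  -- Both sides of coassociativity turn multiplication by `q` into the same operator on the triple
  -- tensor product.
  have key : ∀ (q : ℕ+ ⊕ ℕ) (t : SuperSym ⊗[ℚ] SuperSym),
      TensorProduct.assoc ℚ SuperSym SuperSym SuperSym
          (comul.rTensor SuperSym (primitiveMul q t)) =
        primitiveMul₃ q (TensorProduct.assoc ℚ SuperSym SuperSym SuperSym (comul.rTensor SuperSym t)) := by
    intro q t
    induction t using TensorProduct.induction_on with
    | zero => simp
    | tmul a b =>
      simp only [primitiveMul_tmul, map_add, LinearMap.rTensor_tmul, comul_gen_mul, comul_twist]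
      induction comul a using TensorProduct.induction_on with
      | zero => simp
      | tmul c d =>
        simp only [primitiveMul_tmul, primitiveMul₃_tmul, TensorProduct.map_tmul,
          TensorProduct.add_tmul, map_add, TensorProduct.assoc_tmul, TensorProduct.tmul_add,
          add_assoc]
      | add s t hs ht =>
        simp only [map_add, TensorProduct.add_tmul] at hs ht ⊢
        rw [← hs, ← ht]
        abel
    | add s t hs ht => simp only [map_add] at hs ht ⊢; rw [hs, ht]
  have key' : ∀ (q : ℕ+ ⊕ ℕ) (t : SuperSym ⊗[ℚ] SuperSym),
      comul.lTensor SuperSym (primitiveMul q t) =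
        primitiveMul₃ q (comul.lTensor SuperSym t) := by
    intro q t
    induction t using TensorProduct.induction_on with
    | zero => simp
    | tmul a b => simp [primitiveMul_tmul, primitiveMul₃_tmul, comul_gen_mul]
    | add s t hs ht => simp only [map_add] at hs ht ⊢; rw [hs, ht]
  refine hom_ext ?_ fun q f hf => ?_
  · simp [comul_one]
  · simp only [LinearMap.comp_apply, LinearEquiv.coe_coe, comul_gen_mul] at hf ⊢
    rw [key, key', hf]

theorem rTensor_counit_comul :
    counit.rTensor SuperSym ∘ₗ comul = TensorProduct.mk ℚ ℚ SuperSym 1 := by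
  have key : ∀ (q : ℕ+ ⊕ ℕ) (t : SuperSym ⊗[ℚ] SuperSym),
      counit.rTensor SuperSym (primitiveMul q t) =
        (LinearMap.mulLeft ℚ (gen q)).lTensor ℚ (counit.rTensor SuperSym t) := by
    intro q t
    induction t using TensorProduct.induction_on with
    | zero => simp
    | tmul a b => simp [primitiveMul_tmul]
    | add s t hs ht => simp only [map_add, hs, ht]
  refine hom_ext ?_ fun q f hf => ?_
  · simp [comul_one]
  · rw [LinearMap.comp_apply] at hf ⊢
    rw [comul_gen_mul, key, hf]
    rfl

theorem lTensor_counit_comul :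
    counit.lTensor SuperSym ∘ₗ comul = (TensorProduct.mk ℚ SuperSym ℚ).flip 1 := by
  have key : ∀ (q : ℕ+ ⊕ ℕ) (t : SuperSym ⊗[ℚ] SuperSym),
      counit.lTensor SuperSym (primitiveMul q t) =
        (LinearMap.mulLeft ℚ (gen q)).rTensor ℚ (counit.lTensor SuperSym t) := by
    intro q t
    induction t using TensorProduct.induction_on with
    | zero => simp
    | tmul a b => simp [primitiveMul_tmul]
    | add s t hs ht => simp only [map_add, hs, ht]
  refine hom_ext ?_ fun q f hf => ?_
  · simp [comul_one]
  · rw [LinearMap.comp_apply] at hf ⊢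
    rw [comul_gen_mul, key, hf]
    rfl

/-- The two terms of `primitiveMul q (a ⊗ b)` contribute `-q S(a) b` and `twist q (S a) q b = q S(a)
b`, which cancel. -/
theorem mul_antipode_rTensor_comul :
    LinearMap.mul' ℚ SuperSym ∘ₗ antipode.rTensor SuperSym ∘ₗ comul =
      Algebra.linearMap ℚ SuperSym ∘ₗ counit := by
  have key : ∀ (q : ℕ+ ⊕ ℕ) (t : SuperSym ⊗[ℚ] SuperSym),
      LinearMap.mul' ℚ SuperSym (antipode.rTensor SuperSym (primitiveMul q t)) = 0 := by
    intro q t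
    induction t using TensorProduct.induction_on with
    | zero => simp
    | tmul a b =>
      have h : antipode (twist q a) = twist q (antipode a) := diag_comm _ _ _
      simp [primitiveMul_tmul, antipode_gen_mul, h, ← mul_assoc, twist_mul_gen]
    | add s t hs ht => simp only [map_add, hs, ht, add_zero]
  refine hom_ext ?_ fun q f hf => ?_
  · simp [comul_one, antipode_one]
  · simp [comul_gen_mul, key]

theorem mul_antipode_lTensor_comul :
    LinearMap.mul' ℚ SuperSym ∘ₗ antipode.lTensor SuperSym ∘ₗ comul =
      Algebra.linearMap ℚ SuperSym ∘ₗ counit := by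
  have key : ∀ (q : ℕ+ ⊕ ℕ) (t : SuperSym ⊗[ℚ] SuperSym),
      LinearMap.mul' ℚ SuperSym (antipode.lTensor SuperSym (primitiveMul q t)) = 0 := by
    intro q t
    induction t using TensorProduct.induction_on with
    | zero => simp
    | tmul a b => simp [primitiveMul_tmul, antipode_gen_mul, ← mul_assoc, twist_mul_gen]
    | add s t hs ht => simp only [map_add, hs, ht, add_zero]
  refine hom_ext ?_ fun q f hf => ?_
  · simp [comul_one, antipode_one]
  · simp [comul_gen_mul, key]

theorem comm_comulHom (f : SuperSym) :
    GradedTensorProduct.comm fermionic fermionic (comulHom f) = comulHom f := by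
  induction f using SuperSym.induction with
  | one => simp
  | gen_mul q f hf =>
    have h1 := GradedTensorProduct.comm_coe_tmul_coe (R := ℚ) fermionic fermionic
      ⟨gen q, gen_mem_fermionic q⟩ ⟨1, SetLike.GradedOne.one_mem⟩
    have h2 := GradedTensorProduct.comm_coe_tmul_coe (R := ℚ) fermionic fermionic
      ⟨1, SetLike.GradedOne.one_mem⟩ ⟨gen q, gen_mem_fermionic q⟩
    simp only [zero_mul, mul_zero, uzpow_zero, one_smul] at h1 h2
    rw [map_mul, map_mul, hf, comulHom_gen, comulGen, map_add, map_add]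
    congr 1
    refine (congrArg₂ _ h1 h2).trans (add_comm _ _)
  | add f g hf hg => rw [map_add, map_add, hf, hg]
  | smul c f hf => rw [map_smul, map_smul, hf]

/-- Stated for any degree additive in the parts, so as to serve both the fermionic grading and the
simple grading. -/
theorem comul_mem_tensorDegree {D : SuperPartition → ℕ} {d : ℕ+ ⊕ ℕ → ℕ}
    (h0 : D SuperPartition.empty = 0)
    (h1 : ∀ r L, D (L.addEven r) = d (.inl r) + D L)
    (h2 : ∀ k L, k ∉ L.a → D (L.addOdd k) = d (.inr k) + D L) (n : ℕ) {f : SuperSym}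
    (hf : f ∈ Submodule.span ℚ (SuperPartition.powerSum '' {L | D L = n})) :
    comul f ∈ tensorDegree
      (fun n => Submodule.span ℚ (SuperPartition.powerSum '' {L | D L = n})) n := by
  set 𝒢 := fun n => Submodule.span ℚ (SuperPartition.powerSum '' {L | D L = n}) with h𝒢
  have hmem : ∀ {i j : ℕ} {a b : SuperSym}, a ∈ 𝒢 i → b ∈ 𝒢 j →
      a ⊗ₜ[ℚ] b ∈ tensorDegree 𝒢 (i + j) := fun {i j a b} ha hb =>
    (le_iSup₂_of_le (f := fun (p : ℕ × ℕ) (_ : p.1 + p.2 = i + j) =>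
      LinearMap.range (TensorProduct.map (𝒢 p.1).subtype (𝒢 p.2).subtype)) (i, j) rfl le_rfl)
      ⟨(⟨a, ha⟩ : 𝒢 i) ⊗ₜ (⟨b, hb⟩ : 𝒢 j), rfl⟩
  have hstep : ∀ q n, ∀ t ∈ tensorDegree 𝒢 n, primitiveMul q t ∈ tensorDegree 𝒢 (d q + n) := by
    intro q n
    change tensorDegree 𝒢 n ≤ (tensorDegree 𝒢 (d q + n)).comap (primitiveMul q)
    refine iSup₂_le fun p hp => ?_
    rintro _ ⟨t, rfl⟩
    rw [Submodule.mem_comap]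
    induction t using TensorProduct.induction_on with
    | zero => simp
    | tmul a b =>
      rw [TensorProduct.map_tmul, primitiveMul_tmul]
      refine add_mem ?_ ?_
      · have := hmem (span_comap_gen_mul h1 h2 q p.1 a.2) b.2
        rwa [add_assoc, hp] at this
      · have := hmem (diag_mem_span (fun L => (-1) ^ (parity q * L.fermionicDegree)) _ a.2) (span_comap_gen_mul h1 h2 q p.2 b.2)
        rwa [add_left_comm, hp] at this
    | add s t hs ht => rw [map_add, map_add]; exact add_mem hs ht
  suffices h : 𝒢 n ≤ (tensorDegree 𝒢 n).comap comul from h hf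
  refine Submodule.span_le.2 ?_
  rintro _ ⟨L, rfl, rfl⟩
  rw [SetLike.mem_coe, Submodule.mem_comap]
  clear hf
  induction L using SuperPartition.induction with
  | h0 =>
    have h1 : (1 : SuperSym) ∈ 𝒢 0 :=
      Submodule.subset_span ⟨_, h0, SuperPartition.powerSum_empty⟩
    rw [h0, SuperPartition.powerSum_empty, comul_one]
    simpa using hmem h1 h1
  | h1 r L ih =>
    rw [h1, ← SuperPartition.powerSum_mul_powerSum]
    have := hstep (.inl r) _ _ ih
    rwa [← comul_gen_mul] at this
  | h2 k L hk ih =>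
    obtain ⟨ε, hε, h⟩ := SuperPartition.oddPowerSum_mul_powerSum hk
    have := Submodule.smul_mem _ ε (hstep (.inr k) _ _ ih)
    rwa [← comul_gen_mul, ← map_smul, gen, Sum.elim_inr, h, smul_smul, hε, one_smul,
      ← h2 k L hk] at this

end SuperSym

/-! ### The Hopf algebra -/

namespace SuperSym

/-- The Hopf algebra of symmetric functions in superspace. -/
def hopfAlgebra : SuperHopfAlgebra fermionic where
  comul := comul
  counit := counit
  coassoc := comul_coassoc
  rTensor_counit_comp_comul := rTensor_counit_comul
  lTensor_counit_comp_comul := lTensor_counit_comul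
  comul_one := by rw [of_comul, map_one]
  comul_mul f g := by rw [of_comul, of_comul, of_comul, map_mul]
  counit_one := counit_one
  counit_mul := counit_mul
  antipode := antipode
  mul_antipode_rTensor_comul := mul_antipode_rTensor_comul
  mul_antipode_lTensor_comul := mul_antipode_lTensor_comul
  comul_mem m f hf := by
    have h := comul_mem_tensorDegree (D := SuperPartition.fermionicDegree) (d := parity) rfl
      (fun r L => by simp [SuperPartition.fermionicDegree, SuperPartition.addEven, parity])
      (fun k L hk => SuperPartition.fermionicDegree_addOdd hk) m (fermionic_eq_span m ▸ hf)
    rwa [← funext fermionic_eq_span] at h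
  counit_of_mem m hm f hf := by
    suffices h : fermionic m ≤ LinearMap.ker counit from h hf
    rw [fermionic_eq_span, Submodule.span_le]
    rintro _ ⟨L, rfl, rfl⟩
    rw [SetLike.mem_coe, LinearMap.mem_ker, counit_powerSum, if_neg]
    rintro rfl
    exact hm rfl
  antipode_mem m f hf := by
    rw [fermionic_eq_span] at hf ⊢
    exact diag_mem_span _ _ hf

theorem counit_of_mem_simpleDegree (k : ℕ) (hk : k ≠ 0) (f : SuperSym)
    (hf : f ∈ simpleDegree k) : counit f = 0 := by
  suffices h : simpleDegree k ≤ LinearMap.ker counit from h hf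
  rw [simpleDegree_eq_span, Submodule.span_le]
  rintro _ ⟨L, rfl, rfl⟩
  rw [SetLike.mem_coe, LinearMap.mem_ker, counit_powerSum, if_neg]
  rintro rfl
  exact hk rfl

theorem isGradedConnected_hopfAlgebra : hopfAlgebra.IsGradedConnected simpleDegree where
  isInternal := by
    rw [funext simpleDegree_eq_span]
    exact isInternal_span_image
  mul_mem i j f hf g hg := by
    suffices h : simpleDegree i ≤ (simpleDegree (i + j)).comap (LinearMap.mulRight ℚ g) from h hf
    refine iSup₂_le fun p hp f hf => ?_
    suffices h : simpleDegree j ≤ (simpleDegree (i + j)).comap (LinearMap.mulLeft ℚ f) from h hg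
    refine iSup₂_le fun p' hp' g hg => ?_
    have h := bigraded_le_simpleDegree _ _ (mul_mem_bigraded hf hg)
    rwa [add_add_add_comm, hp, hp'] at h
  comul_mem k f hf := by
    have h := comul_mem_tensorDegree
      (D := fun L => L.totalDegree + L.fermionicDegree) (d := fun q => genDegree q + parity q) rfl
      (fun r L => by
        simp [SuperPartition.totalDegree, SuperPartition.fermionicDegree, SuperPartition.addEven,
          parity, genDegree]
        omega)
      (fun k L hk => by
        simp [SuperPartition.totalDegree, SuperPartition.fermionicDegree, SuperPartition.addOdd,
          parity, genDegree, hk]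
        omega) k (simpleDegree_eq_span k ▸ hf)
    rwa [← funext simpleDegree_eq_span] at h
  finrank_zero := by
    -- Connectedness needs the sum of the two degrees: `p̃_0` has total degree 0 but fermionic
    -- degree 1.
    have h : {L : SuperPartition | L.totalDegree + L.fermionicDegree = 0} =
        {SuperPartition.empty} := by
      ext L
      refine ⟨fun hL => ?_, ?_⟩
      · have hL' : L.totalDegree + L.fermionicDegree = 0 := hL
        obtain ⟨a, s⟩ := L
        have h1 : a = ∅ := Finset.card_eq_zero.1 (Nat.eq_zero_of_add_eq_zero_left hL')
        have h2 : (s.map PNat.val).sum = 0 :=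
          Nat.eq_zero_of_add_eq_zero_left (Nat.eq_zero_of_add_eq_zero_right hL')
        have h3 : s = 0 := Multiset.eq_zero_of_forall_notMem fun r hr =>
          r.ne_zero (Multiset.sum_eq_zero_iff.1 h2 _ (Multiset.mem_map_of_mem _ hr))
        rw [h1, h3]
        rfl
      · rintro rfl
        rfl
    rw [simpleDegree_eq_span, h, Set.image_singleton, SuperPartition.powerSum_empty]
    refine finrank_span_singleton fun h1 => ?_
    have := congrArg counit h1
    simp at this

theorem isCocommutative_hopfAlgebra : hopfAlgebra.IsCocommutative := comm_comulHom

/-! ### Diagonal bilinear forms -/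

theorem gen_inl (r : ℕ+) : gen (.inl r) = powerSum r := rfl

theorem gen_inr (k : ℕ) : gen (.inr k) = oddPowerSum k := rfl

theorem basis_repr_powerSum (L : SuperPartition) :
    basis.repr L.powerSum = Finsupp.single L 1 := by
  rw [← basis_apply, Module.Basis.repr_self]

/-- The bilinear form for which the `p_Λ` are orthogonal, `⟨p_Λ, p_Λ⟩ = c Λ`. -/
def form (c : SuperPartition → ℚ) : SuperSym →ₗ[ℚ] SuperSym →ₗ[ℚ] ℚ :=
  basis.constr ℚ fun L => c L • basis.coord L

theorem form_powerSum (c : SuperPartition → ℚ) (L M : SuperPartition) :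
    form c L.powerSum M.powerSum = if L = M then c L else 0 := by
  rw [← basis_apply L, form, Module.Basis.constr_basis, LinearMap.smul_apply,
    Module.Basis.coord_apply, basis_repr_powerSum]
  simp [Finsupp.single_apply, eq_comm]

theorem bilin_ext {M : Type*} [AddCommGroup M] [Module ℚ M]
    {φ ψ : SuperSym →ₗ[ℚ] SuperSym →ₗ[ℚ] M}
    (h : ∀ L L' : SuperPartition, φ L.powerSum L'.powerSum = ψ L.powerSum L'.powerSum) : φ = ψ :=
  hom_ext_powerSum fun L => hom_ext_powerSum fun L' => h L L'

theorem form_comm (c : SuperPartition → ℚ) (f g : SuperSym) : form c f g = form c g f := by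
  suffices h : form c = (form c).flip from LinearMap.congr_fun₂ h f g
  refine bilin_ext fun L M => ?_
  rw [LinearMap.flip_apply, form_powerSum, form_powerSum]
  by_cases h : L = M
  · rw [h]
  · rw [if_neg h, if_neg (Ne.symm h)]

theorem nondegenerate_form {c : SuperPartition → ℚ} (hc : ∀ L, c L ≠ 0) :
    (form c).Nondegenerate := by
  have h : (form c).SeparatingLeft := by
    intro f hf
    refine basis.ext_elem fun L => ?_
    have h1 : ∀ f, form c f L.powerSum = c L * basis.repr f L := by
      intro f
      suffices h : (form c).flip L.powerSum = c L • basis.coord L from LinearMap.congr_fun h f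
      refine hom_ext_powerSum fun M => ?_
      rw [LinearMap.flip_apply, form_powerSum, LinearMap.smul_apply,
        Module.Basis.coord_apply, basis_repr_powerSum]
      by_cases hM : M = L
      · simp [hM]
      · simp [hM]
    have h2 := (h1 f).symm.trans (hf _)
    rw [map_zero, Finsupp.zero_apply]
    exact (mul_eq_zero.1 h2).resolve_left (hc L)
  exact ⟨h, fun g hg => h g fun f => (form_comm c g f).trans (hg f)⟩

theorem form_one (c : SuperPartition → ℚ) (hc : c SuperPartition.empty = 1) (f : SuperSym) :
    form c 1 f = counit f := by
  suffices h : form c 1 = counit from LinearMap.congr_fun h f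
  refine hom_ext_powerSum fun L => ?_
  rw [← SuperPartition.powerSum_empty, form_powerSum, counit_powerSum, hc]
  simp [eq_comm]

theorem form_diag (c d : SuperPartition → ℚ) (f g : SuperSym) :
    form c (diag d f) g = form c f (diag d g) := by
  suffices h : form c ∘ₗ diag d = (form c).compl₂ (diag d) from LinearMap.congr_fun₂ h f g
  refine bilin_ext fun L M => ?_
  rw [LinearMap.comp_apply, LinearMap.compl₂_apply, diag_powerSum, diag_powerSum, map_smul,
    LinearMap.smul_apply, map_smul, form_powerSum]
  by_cases h : L = M
  · rw [h]
  · simp [h]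

/-! ### The extended Hall scalar product -/

theorem _root_.SuperPartition.z_addEven (r : ℕ+) (L : SuperPartition) :
    (L.addEven r).z = ((r : ℕ) * (L.s.count r + 1 : ℕ) : ℚ) * L.z := by
  -- Absent parts contribute the factor 1, so both products can be taken over one index set
  -- containing `r`.
  have h : ∀ (s : Multiset ℕ+) (T : Finset ℕ+), s.toFinset ⊆ T →
      ∏ i ∈ s.toFinset, ((i : ℕ) : ℚ) ^ s.count i * ((s.count i).factorial : ℚ) =
        ∏ i ∈ T, ((i : ℕ) : ℚ) ^ s.count i * ((s.count i).factorial : ℚ) := by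
    intro s T hT
    refine Finset.prod_subset hT fun i _ hi => ?_
    rw [Multiset.count_eq_zero_of_notMem (by simpa using hi)]
    simp
  rw [SuperPartition.z, SuperPartition.z, h _ (insert r L.s.toFinset) (by simp [SuperPartition.addEven]),
    h L.s (insert r L.s.toFinset) (by simp), ← Finset.mul_prod_erase _ _ (Finset.mem_insert_self r _),
    ← Finset.mul_prod_erase _ _ (Finset.mem_insert_self r _), ← mul_assoc]
  refine congrArg₂ _ ?_ (Finset.prod_congr rfl fun i hi => ?_)
  · simp only [SuperPartition.addEven, Multiset.count_cons_self, pow_succ, Nat.factorial_succ]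
    push_cast
    ring
  · have hi : i ≠ r := Finset.ne_of_mem_erase hi
    simp only [SuperPartition.addEven, Multiset.count_cons_of_ne hi]

theorem _root_.SuperPartition.z_ne_zero (L : SuperPartition) : L.z ≠ 0 := by
  refine Finset.prod_ne_zero_iff.2 fun i _ => mul_ne_zero (pow_ne_zero _ ?_) ?_
  · exact Nat.cast_ne_zero.2 i.ne_zero
  · exact Nat.cast_ne_zero.2 (Nat.factorial_ne_zero _)

/-- The extended Hall scalar product. -/
def hallForm : SuperSym →ₗ[ℚ] SuperSym →ₗ[ℚ] ℚ := form SuperPartition.z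

theorem hallForm_powerSum (L M : SuperPartition) :
    hallForm L.powerSum M.powerSum = if L = M then L.z else 0 := form_powerSum _ L M

theorem hallForm_one (f : SuperSym) : hallForm 1 f = counit f :=
  form_one _ (by simp [SuperPartition.z, SuperPartition.empty]) f

/-- The superpartition with a single part. -/
def _root_.SuperPartition.single : ℕ+ ⊕ ℕ → SuperPartition :=
  Sum.elim (fun r => ⟨∅, {r}⟩) fun k => ⟨{k}, 0⟩

theorem gen_eq_powerSum (q : ℕ+ ⊕ ℕ) : gen q = (SuperPartition.single q).powerSum := by
  cases q <;> simp [gen, SuperPartition.single, SuperPartition.powerSum]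

theorem hallForm_gen_twist (q q' : ℕ+ ⊕ ℕ) (f : SuperSym) :
    hallForm (gen q) (twist q' f) = (-1) ^ (parity q * parity q') * hallForm (gen q) f := by
  have h := form_diag SuperPartition.z (fun L => (-1) ^ (parity q' * L.fermionicDegree)) (gen q) f
  refine Eq.trans h.symm ?_
  have h1 := twist_of_mem_fermionic q' (gen_mem_fermionic q)
  rw [twist] at h1
  rw [h1, map_smul, mul_comm (parity q)]
  rfl

/-- A generator is orthogonal to every `p_Λ` that does not have exactly one part, so only the
constant term of `f` contributes. -/
theorem hallForm_gen_gen_mul (q q' : ℕ+ ⊕ ℕ) (f : SuperSym) :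
    hallForm (gen q) (gen q' * f) = hallForm (gen q) (gen q') * counit f := by
  suffices h : hallForm (gen q) ∘ₗ LinearMap.mulLeft ℚ (gen q') =
      hallForm (gen q) (gen q') • counit from LinearMap.congr_fun h f
  refine hom_ext_powerSum fun L => ?_
  rw [LinearMap.comp_apply, LinearMap.mulLeft_apply, LinearMap.smul_apply, counit_powerSum]
  have hlen : ∀ M : SuperPartition, M.length = L.length + 1 → L ≠ SuperPartition.empty →
      hallForm (gen q) M.powerSum = 0 := by
    intro M hM hL
    rw [gen_eq_powerSum, hallForm_powerSum, if_neg]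
    rintro rfl
    have h1 : (SuperPartition.single q).length = 1 := by
      cases q <;> simp [SuperPartition.single, SuperPartition.length]
    refine hL ?_
    have h2 : L.length = 0 := by omega
    obtain ⟨a, s⟩ := L
    have h3 : a = ∅ := Finset.card_eq_zero.1 (Nat.eq_zero_of_add_eq_zero_right h2)
    have h4 : s = 0 := Multiset.card_eq_zero.1 (Nat.eq_zero_of_add_eq_zero_left h2)
    rw [h3, h4]
    rfl
  by_cases hL : L = SuperPartition.empty
  · rw [hL, SuperPartition.powerSum_empty, mul_one, if_pos rfl, smul_eq_mul, mul_one]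
  · rw [if_neg hL, smul_zero]
    cases q' with
    | inl r =>
      rw [gen_inl, SuperPartition.powerSum_mul_powerSum]
      exact hlen _ (SuperPartition.length_addEven r L) hL
    | inr k =>
      rw [gen_inr]
      by_cases hk : k ∈ L.a
      · rw [SuperPartition.oddPowerSum_mul_powerSum_of_mem hk, map_zero]
      · obtain ⟨ε, -, h⟩ := SuperPartition.oddPowerSum_mul_powerSum hk
        rw [h, map_smul, hlen _ (SuperPartition.length_addOdd hk) hL, smul_zero]

/-- The derivation adjoint to the multiplication by a power sum. -/
def derivation (q : ℕ+ ⊕ ℕ) : SuperSym →ₗ[ℚ] SuperSym :=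
  (TensorProduct.lid ℚ SuperSym).toLinearMap ∘ₗ (hallForm (gen q)).rTensor SuperSym ∘ₗ comul

theorem derivation_one (q : ℕ+ ⊕ ℕ) : derivation q 1 = 0 := by
  have h : hallForm (gen q) 1 = 0 := by
    rw [hallForm, form_comm]
    exact (hallForm_one _).trans (counit_gen q)
  simp [derivation, comul_one, h]

theorem derivation_gen_mul (q q' : ℕ+ ⊕ ℕ) (f : SuperSym) :
    derivation q (gen q' * f) = hallForm (gen q) (gen q') • f +
      (-1 : ℚ) ^ (parity q * parity q') • (gen q' * derivation q f) := by
  have key : ∀ t : SuperSym ⊗[ℚ] SuperSym,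
      TensorProduct.lid ℚ SuperSym ((hallForm (gen q)).rTensor SuperSym (primitiveMul q' t)) =
        hallForm (gen q) (gen q') • TensorProduct.lid ℚ SuperSym (counit.rTensor SuperSym t) +
          (-1 : ℚ) ^ (parity q * parity q') • (gen q' *
            TensorProduct.lid ℚ SuperSym ((hallForm (gen q)).rTensor SuperSym t)) := by
    intro t
    induction t using TensorProduct.induction_on with
    | zero => simp
    | tmul a b =>
      simp only [primitiveMul_tmul, map_add, LinearMap.rTensor_tmul, TensorProduct.lid_tmul,
        hallForm_gen_gen_mul, hallForm_gen_twist, mul_smul, mul_smul_comm]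
    | add s t hs ht =>
      simp only [map_add, hs, ht, smul_add, mul_add]
      abel
  have h := LinearMap.congr_fun rTensor_counit_comul f
  rw [LinearMap.comp_apply] at h
  simp only [derivation, LinearMap.comp_apply, LinearEquiv.coe_coe, comul_gen_mul, key, h]
  simp

/-- Both sides contract the leftmost factor of the iterated coproduct with `q`, so this is
coassociativity. -/
theorem comul_derivation (q : ℕ+ ⊕ ℕ) (f : SuperSym) :
    comul (derivation q f) = (derivation q).rTensor SuperSym (comul f) := by
  have h1 : ∀ t : SuperSym ⊗[ℚ] SuperSym,
      comul (TensorProduct.lid ℚ SuperSym ((hallForm (gen q)).rTensor SuperSym t)) =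
        TensorProduct.lid ℚ (SuperSym ⊗[ℚ] SuperSym)
          ((hallForm (gen q)).rTensor (SuperSym ⊗[ℚ] SuperSym) (comul.lTensor SuperSym t)) := by
    intro t
    induction t using TensorProduct.induction_on with
    | zero => simp
    | tmul a b => simp
    | add s t hs ht => simp only [map_add, hs, ht]
  have h2 : ∀ t : SuperSym ⊗[ℚ] SuperSym, (derivation q).rTensor SuperSym t =
      TensorProduct.lid ℚ (SuperSym ⊗[ℚ] SuperSym)
        ((hallForm (gen q)).rTensor (SuperSym ⊗[ℚ] SuperSym)
          (TensorProduct.assoc ℚ SuperSym SuperSym SuperSym (comul.rTensor SuperSym t))) := by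
    intro t
    induction t using TensorProduct.induction_on with
    | zero => simp
    | tmul a b =>
      simp only [LinearMap.rTensor_tmul, derivation, LinearMap.comp_apply, LinearEquiv.coe_coe]
      induction comul a using TensorProduct.induction_on with
      | zero => simp
      | tmul c d => simp [TensorProduct.smul_tmul']
      | add s t hs ht => simp only [map_add, TensorProduct.add_tmul, hs, ht]
    | add s t hs ht => simp only [map_add, hs, ht]
  have h3 := LinearMap.congr_fun comul_coassoc f
  simp only [LinearMap.comp_apply, LinearEquiv.coe_coe] at h3
  rw [h2, h3, ← h1]
  rfl

theorem hallForm_gen_gen_of_ne {q q' : ℕ+ ⊕ ℕ} (h : q ≠ q') :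
    hallForm (gen q) (gen q') = 0 := by
  rw [gen_eq_powerSum, gen_eq_powerSum, hallForm_powerSum, if_neg]
  intro h'
  rcases q with r | k <;> rcases q' with r' | k' <;>
    simp_all [SuperPartition.single]

theorem hallForm_gen_inl (r : ℕ+) : hallForm (gen (.inl r)) (gen (.inl r)) = (r : ℕ) := by
  rw [gen_eq_powerSum, hallForm_powerSum, if_pos rfl]
  simp [SuperPartition.single, SuperPartition.z]

theorem hallForm_gen_inr (k : ℕ) : hallForm (gen (.inr k)) (gen (.inr k)) = 1 := by
  rw [gen_eq_powerSum, hallForm_powerSum, if_pos rfl]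
  simp [SuperPartition.single, SuperPartition.z]

/-- The operator is `r ∂/∂p_r`; the factor `r * count` is the one by which `z` grows when a part `r`
is added. -/
theorem derivation_inl_powerSum (r : ℕ+) (L : SuperPartition) :
    derivation (.inl r) L.powerSum =
      ((r : ℕ) * L.s.count r : ℚ) • (⟨L.a, L.s.erase r⟩ : SuperPartition).powerSum := by
  induction L using SuperPartition.induction with
  | h0 => rw [SuperPartition.powerSum_empty, derivation_one]; simp [SuperPartition.empty]
  | h1 r' L ih =>
    have h := derivation_gen_mul (.inl r) (.inl r') L.powerSum
    rw [gen_inl, SuperPartition.powerSum_mul_powerSum, ih,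
      mul_smul_comm, SuperPartition.powerSum_mul_powerSum] at h
    rw [h]
    by_cases hr : r = r'
    · subst hr
      have h1 := hallForm_gen_inl r
      rw [gen, Sum.elim_inl] at h1
      by_cases hrs : r ∈ L.s
      · simp [h1, gen, parity, SuperPartition.addEven, Multiset.cons_erase hrs, ← add_smul]
        ring_nf
      · simp [h1, gen, parity, SuperPartition.addEven, Multiset.count_eq_zero_of_notMem hrs]
    · have h1 := hallForm_gen_gen_of_ne (q := .inl r) (q' := .inl r') (by simpa using hr)
      rw [gen, Sum.elim_inl, Sum.elim_inl] at h1
      simp [h1, gen, parity, SuperPartition.addEven, Multiset.count_cons_of_ne hr,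
        Multiset.erase_cons_tail _ (Ne.symm hr)]
  | h2 k L hk ih =>
    obtain ⟨ε, hε, h⟩ := SuperPartition.exists_oddPowerSum_mul_powerSum_mk hk
    have h' : ∀ s, (SuperPartition.addOdd k ⟨L.a, s⟩).powerSum =
        ε • (gen (.inr k) * (SuperPartition.mk L.a s).powerSum) := by
      intro s
      rw [gen, Sum.elim_inr, h, smul_smul, hε, one_smul]
    have h2 := derivation_gen_mul (.inl r) (.inr k) L.powerSum
    rw [hallForm_gen_gen_of_ne (by simp), ih, zero_smul, zero_add] at h2
    rw [h' L.s, map_smul]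
    refine (congrArg (ε • ·) h2).trans ?_
    have h3 := h' (L.s.erase r)
    simp only [SuperPartition.addOdd] at h3 ⊢
    rw [h3, mul_smul_comm, smul_comm ε]
    simp [parity, smul_comm ε]

theorem derivation_inr_powerSum_of_notMem {k : ℕ} {L : SuperPartition} (hk : k ∉ L.a) :
    derivation (.inr k) L.powerSum = 0 := by
  induction L using SuperPartition.induction with
  | h0 => rw [SuperPartition.powerSum_empty, derivation_one]
  | h1 r L ih =>
    have h := derivation_gen_mul (.inr k) (.inl r) L.powerSum
    rw [ih hk, hallForm_gen_gen_of_ne (by simp), zero_smul, mul_zero, smul_zero, add_zero] at h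
    rwa [← SuperPartition.powerSum_mul_powerSum]
  | h2 j L hj ih =>
    obtain ⟨ε, hε, h⟩ := SuperPartition.oddPowerSum_mul_powerSum hj
    have hk' : k ≠ j ∧ k ∉ L.a := by simpa [SuperPartition.addOdd] using hk
    have h2 := derivation_gen_mul (.inr k) (.inr j) L.powerSum
    rw [ih hk'.2, hallForm_gen_gen_of_ne (by simpa using hk'.1), zero_smul, mul_zero, smul_zero,
      add_zero, gen, Sum.elim_inr, h, map_smul] at h2
    rw [← one_smul ℚ (derivation _ _), ← hε, mul_smul, h2, smul_zero]

theorem derivation_inr_mul_powerSum {k : ℕ} {L : SuperPartition} (hk : k ∉ L.a) :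
    derivation (.inr k) (oddPowerSum k * L.powerSum) = L.powerSum := by
  have h := derivation_gen_mul (.inr k) (.inr k) L.powerSum
  rw [derivation_inr_powerSum_of_notMem hk, hallForm_gen_inr, one_smul, mul_zero, smul_zero,
    add_zero] at h
  exact h

/-- Checked on the basis. For an even generator it is the recursion `z_addEven`. For an odd one, `z`
does not change, and the sorting sign appears once on each side. -/
theorem hallForm_gen_mul (q : ℕ+ ⊕ ℕ) (f g : SuperSym) :
    hallForm (gen q * f) g = hallForm f (derivation q g) := by
  suffices h : hallForm ∘ₗ LinearMap.mulLeft ℚ (gen q) = hallForm.compl₂ (derivation q) from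
    LinearMap.congr_fun₂ h f g
  refine bilin_ext fun L M => ?_
  rw [LinearMap.comp_apply, LinearMap.compl₂_apply, LinearMap.mulLeft_apply]
  cases q with
  | inl r =>
    rw [derivation_inl_powerSum, gen, Sum.elim_inl, SuperPartition.powerSum_mul_powerSum, map_smul,
      hallForm_powerSum, hallForm_powerSum]
    by_cases hr : r ∈ M.s
    · obtain ⟨s, hs⟩ := Multiset.exists_cons_of_mem hr
      obtain ⟨a, s'⟩ := M
      obtain rfl : s' = r ::ₘ s := hs
      obtain ⟨b, t⟩ := L
      by_cases h : b = a ∧ t = s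
      · obtain ⟨rfl, rfl⟩ := h
        rw [if_pos (show SuperPartition.addEven r ⟨b, t⟩ = ⟨b, r ::ₘ t⟩ from rfl),
          if_pos (by simp), SuperPartition.z_addEven]
        simp
      · rw [if_neg, if_neg, smul_zero]
        · simpa using h
        · simpa [SuperPartition.addEven] using h
    · rw [if_neg, Multiset.count_eq_zero_of_notMem hr]
      · simp
      · rintro rfl
        simp [SuperPartition.addEven] at hr
  | inr k =>
    rw [gen, Sum.elim_inr]
    by_cases hM : k ∈ M.a
    -- Writing `M` as a superpartition with `k` added brings `p̃_k` to the front, where the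
    -- derivation just removes it.
    · obtain ⟨M, hkM, rfl⟩ : ∃ M' : SuperPartition, k ∉ M'.a ∧ M = M'.addOdd k :=
        ⟨⟨M.a.erase k, M.s⟩, by simp,
          by simp [SuperPartition.addOdd, Finset.insert_erase hM]⟩
      obtain ⟨ε, hε, h⟩ := SuperPartition.oddPowerSum_mul_powerSum hkM
      have h1 : (M.addOdd k).powerSum = ε • (oddPowerSum k * M.powerSum) := by
        rw [h, smul_smul, hε, one_smul]
      by_cases hL : L = M
      · subst hL
        rw [h, h1, map_smul (derivation _), derivation_inr_mul_powerSum hkM, ← h1, map_smul,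
          map_smul, LinearMap.smul_apply, hallForm_powerSum, hallForm_powerSum, if_pos rfl,
          if_pos rfl]
        rfl
      · rw [h1, map_smul (derivation _), derivation_inr_mul_powerSum hkM, ← h1, map_smul,
          hallForm_powerSum, if_neg hL, smul_zero]
        by_cases hkL : k ∈ L.a
        · rw [SuperPartition.oddPowerSum_mul_powerSum_of_mem hkL, map_zero, LinearMap.zero_apply]
        · obtain ⟨ε', -, h'⟩ := SuperPartition.oddPowerSum_mul_powerSum hkL
          rw [h', map_smul, LinearMap.smul_apply, hallForm_powerSum, if_neg, smul_zero]
          intro h2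
          have hs : (L.addOdd k).s = (M.addOdd k).s := congrArg SuperPartition.s h2
          refine hL (SuperPartition.ext ?_ hs)
          have h3 := congrArg (fun L : SuperPartition => L.a.erase k) h2
          simpa [SuperPartition.addOdd, Finset.erase_insert hkL, Finset.erase_insert hkM] using h3
    · rw [derivation_inr_powerSum_of_notMem hM, map_zero]
      by_cases hkL : k ∈ L.a
      · rw [SuperPartition.oddPowerSum_mul_powerSum_of_mem hkL, map_zero, LinearMap.zero_apply]
      · obtain ⟨ε', -, h'⟩ := SuperPartition.oddPowerSum_mul_powerSum hkL
        rw [h', map_smul, LinearMap.smul_apply, hallForm_powerSum, if_neg, smul_zero]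
        rintro rfl
        exact hM (Finset.mem_insert_self _ _)

end SuperSym

namespace SuperSym

open SuperHopfAlgebra

/-! ### Self-duality -/

theorem plainTensorPairing_rTensor_derivation (q : ℕ+ ⊕ ℕ) (f g : SuperSym)
    (t : SuperSym ⊗[ℚ] SuperSym) :
    plainTensorPairing hallForm (f ⊗ₜ g) ((derivation q).rTensor SuperSym t) =
      plainTensorPairing hallForm ((gen q * f) ⊗ₜ g) t := by
  induction t using TensorProduct.induction_on with
  | zero => simp
  | tmul a b =>
    rw [LinearMap.rTensor_tmul, plainTensorPairing_tmul, plainTensorPairing_tmul,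
      hallForm_gen_mul]
  | add s t hs ht => simp only [map_add, hs, ht]

theorem plainTensorPairing_one_tmul (g : SuperSym) (t : SuperSym ⊗[ℚ] SuperSym) :
    plainTensorPairing hallForm (1 ⊗ₜ g) t =
      hallForm g (TensorProduct.lid ℚ SuperSym (counit.rTensor SuperSym t)) := by
  induction t using TensorProduct.induction_on with
  | zero => simp
  | tmul a b => simp [plainTensorPairing_tmul, hallForm_one]
  | add s t hs ht => simp only [map_add, hs, ht]

/-- Induction on `f`: a leading generator moves across the form as its derivation, passes through
the coproduct to the left factor, and moves back onto `f`. -/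
theorem hallForm_mul (f g a : SuperSym) :
    hallForm (f * g) a = plainTensorPairing hallForm (f ⊗ₜ g) (comul a) := by
  induction f using SuperSym.induction generalizing a with
  | one =>
    have h := LinearMap.congr_fun rTensor_counit_comul a
    rw [LinearMap.comp_apply] at h
    rw [plainTensorPairing_one_tmul, h, one_mul]
    simp
  | gen_mul q f ih =>
    rw [mul_assoc, hallForm_gen_mul, ih, comul_derivation, plainTensorPairing_rTensor_derivation]
  | add f f' h h' =>
    rw [add_mul, map_add, LinearMap.add_apply, h, h', TensorProduct.add_tmul, map_add,
      LinearMap.add_apply]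
  | smul c f h =>
    rw [smul_mul_assoc, map_smul, LinearMap.smul_apply, h, ← TensorProduct.smul_tmul', map_smul,
      LinearMap.smul_apply]

theorem bilin_tensor_ext {M : Type*} [AddCommGroup M] [Module ℚ M]
    {φ ψ : SuperSym ⊗[ℚ] SuperSym →ₗ[ℚ] SuperSym ⊗[ℚ] SuperSym →ₗ[ℚ] M}
    (h : ∀ F G A B : SuperPartition, φ (F.powerSum ⊗ₜ G.powerSum) (A.powerSum ⊗ₜ B.powerSum) =
      ψ (F.powerSum ⊗ₜ G.powerSum) (A.powerSum ⊗ₜ B.powerSum)) : φ = ψ :=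
  tensor_hom_ext fun F G => tensor_hom_ext fun A B => h F G A B

theorem plainTensorPairing_comm (c : SuperPartition → ℚ) (s t : SuperSym ⊗[ℚ] SuperSym) :
    plainTensorPairing (form c) s t = plainTensorPairing (form c) t s := by
  suffices h : plainTensorPairing (form c) = (plainTensorPairing (form c)).flip from
    LinearMap.congr_fun₂ h s t
  refine bilin_tensor_ext fun F G A B => ?_
  rw [LinearMap.flip_apply, plainTensorPairing_tmul, plainTensorPairing_tmul, form_comm,
    form_comm c G.powerSum]

theorem hallForm_mul_right (f a b : SuperSym) :
    hallForm f (a * b) = plainTensorPairing hallForm (comul f) (a ⊗ₜ b) := by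
  rw [hallForm, plainTensorPairing_comm, form_comm]
  exact hallForm_mul a b f

theorem hallForm_isSelfDualPairing :
    hopfAlgebra.IsSelfDualPairing hallForm (plainTensorPairing hallForm) where
  mul_left := hallForm_mul
  mul_right := hallForm_mul_right
  one_left := hallForm_one
  one_right f := (form_comm _ f 1).trans (hallForm_one f)
  antipode := form_diag _ _

/-! ### Signed extensions of the pairings. -/

theorem signedTensorPairing_powerSum (c : SuperPartition → ℚ) (F G A B : SuperPartition) :
    signedTensorPairing fermionic (form c) (F.powerSum ⊗ₜ G.powerSum)
        (A.powerSum ⊗ₜ B.powerSum) =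
      (-1) ^ (G.fermionicDegree * A.fermionicDegree) *
        plainTensorPairing (form c) (F.powerSum ⊗ₜ G.powerSum) (A.powerSum ⊗ₜ B.powerSum) := by
  rw [signedTensorPairing_tmul _ _ _ _ _ (powerSum_mem_fermionic G) (powerSum_mem_fermionic A),
    plainTensorPairing_tmul]

theorem signedTensorPairing_hallForm (f g h : SuperSym) :
    signedTensorPairing fermionic hallForm (comul f) (g ⊗ₜ h) = hallForm f (h * g) := by
  suffices key : (signedTensorPairing fermionic hallForm ∘ₗ comul) f =
      (hallForm f) ∘ₗ LinearMap.mul' ℚ SuperSym ∘ₗ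
        (TensorProduct.comm ℚ SuperSym SuperSym).toLinearMap from
    LinearMap.congr_fun key (g ⊗ₜ h)
  refine tensor_hom_ext fun G H => ?_
  -- The pairing vanishes unless the second factors agree, so the sign depends on `G` and `H` alone.
  -- It is the sign that exchanges the two factors of the product.
  have h1 : (signedTensorPairing fermionic hallForm).flip (G.powerSum ⊗ₜ H.powerSum) =
      (-1 : ℚ) ^ (H.fermionicDegree * G.fermionicDegree) •
        (plainTensorPairing hallForm).flip (G.powerSum ⊗ₜ H.powerSum) := by
    refine tensor_hom_ext fun L M => ?_
    rw [LinearMap.flip_apply, LinearMap.smul_apply, LinearMap.flip_apply, hallForm,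
      signedTensorPairing_powerSum, smul_eq_mul, plainTensorPairing_tmul, form_powerSum,
      form_powerSum]
    by_cases hM : M = H
    · rw [hM]
    · simp [hM]
  refine (LinearMap.congr_fun h1 (comul f)).trans ?_
  rw [LinearMap.smul_apply, LinearMap.flip_apply, ← hallForm_mul_right]
  simp only [LinearMap.comp_apply, LinearEquiv.coe_coe, TensorProduct.comm_tmul,
    LinearMap.mul'_apply]
  rw [mul_eq_neg_one_pow_smul_mul (powerSum_mem_fermionic H) (powerSum_mem_fermionic G), map_smul]

/-- The bilinear form with `⟨p_Λ, p_Λ⟩ = (-1) ^ (m choose 2) z_{Λ^s}`, where `m` is the fermionic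
degree of `Λ`. -/
def signedForm : SuperSym →ₗ[ℚ] SuperSym →ₗ[ℚ] ℚ :=
  form fun L => (-1) ^ (L.fermionicDegree.choose 2) * L.z

theorem signedForm_powerSum (L M : SuperPartition) : signedForm L.powerSum M.powerSum =
    if L = M then (-1) ^ (L.fermionicDegree.choose 2) * L.z else 0 := form_powerSum _ L M

theorem signedForm_of_mem_fermionic {m : ℕ} {f : SuperSym} (hf : f ∈ fermionic m)
    (a : SuperSym) : signedForm f a = (-1) ^ (m.choose 2) * hallForm f a := by
  have h : signedForm =
      hallForm ∘ₗ diag fun L => (-1) ^ (L.fermionicDegree.choose 2) := by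
    refine bilin_ext fun L M => ?_
    rw [signedForm_powerSum, LinearMap.comp_apply, diag_powerSum, map_smul, LinearMap.smul_apply,
      hallForm_powerSum, smul_eq_mul, mul_ite, mul_zero]
  rw [h, LinearMap.comp_apply,
    diag_of_mem_fermionic (fun n => (-1) ^ (n.choose 2)) hf, map_smul,
    LinearMap.smul_apply, smul_eq_mul]

theorem _root_.Nat.add_choose_two_eq (i j : ℕ) :
    (i + j).choose 2 = i.choose 2 + j.choose 2 + i * j := by
  induction j with
  | zero => simp
  | succ j ih =>
    rw [← add_assoc, Nat.choose_succ_succ' (i + j) 1, Nat.choose_succ_succ' j 1, ih,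
      Nat.choose_one_right, Nat.choose_one_right]
    ring

/-- Orthogonality leaves only `t = F ⊗ G`, where the three signs multiply to `(-1) ^ (i choose 2 + j
choose 2 + i * j)`, with `i` and `j` the fermionic degrees. -/
theorem signedTensorPairing_signedForm (F G : SuperPartition) (t : SuperSym ⊗[ℚ] SuperSym) :
    signedTensorPairing fermionic signedForm (F.powerSum ⊗ₜ G.powerSum) t =
      (-1) ^ ((F.fermionicDegree + G.fermionicDegree).choose 2) *
        plainTensorPairing hallForm (F.powerSum ⊗ₜ G.powerSum) t := by
  suffices h : signedTensorPairing fermionic signedForm (F.powerSum ⊗ₜ G.powerSum) =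
      (-1 : ℚ) ^ ((F.fermionicDegree + G.fermionicDegree).choose 2) •
        plainTensorPairing hallForm (F.powerSum ⊗ₜ G.powerSum) from LinearMap.congr_fun h t
  refine tensor_hom_ext fun A B => ?_
  rw [LinearMap.smul_apply, smul_eq_mul, signedForm, signedTensorPairing_powerSum,
    plainTensorPairing_tmul, plainTensorPairing_tmul, form_powerSum, form_powerSum,
    hallForm_powerSum, hallForm_powerSum, Nat.add_choose_two_eq]
  by_cases hA : F = A
  · subst hA
    by_cases hB : G = B
    · simp only [hB, if_true, pow_add, mul_comm B.fermionicDegree]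
      ring
    · simp [hB]
  · simp [hA]

theorem signedForm_mul (f g a : SuperSym) : signedForm (f * g) a =
    signedTensorPairing fermionic signedForm (f ⊗ₜ g) (comul a) := by
  suffices h : signedForm.flip a ∘ₗ LinearMap.mul' ℚ SuperSym =
      (signedTensorPairing fermionic signedForm).flip (comul a) from
    LinearMap.congr_fun h (f ⊗ₜ g)
  refine tensor_hom_ext fun F G => ?_
  rw [LinearMap.comp_apply, LinearMap.flip_apply, LinearMap.flip_apply, LinearMap.mul'_apply,
    signedTensorPairing_signedForm, ← hallForm_mul]
  exact signedForm_of_mem_fermionic (SetLike.GradedMul.mul_mem (powerSum_mem_fermionic F)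
    (powerSum_mem_fermionic G)) a

/-- Nonzero values occur only on the diagonal, where the sign is symmetric. This gives the second
duality identity from the first. -/
theorem signedTensorPairing_comm (c : SuperPartition → ℚ) (s t : SuperSym ⊗[ℚ] SuperSym) :
    signedTensorPairing fermionic (form c) s t = signedTensorPairing fermionic (form c) t s := by
  suffices h : signedTensorPairing fermionic (form c) =
      (signedTensorPairing fermionic (form c)).flip from LinearMap.congr_fun₂ h s t
  refine bilin_tensor_ext fun F G A B => ?_
  rw [LinearMap.flip_apply, signedTensorPairing_powerSum, signedTensorPairing_powerSum,
    plainTensorPairing_tmul, plainTensorPairing_tmul, form_powerSum, form_powerSum, form_powerSum,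
    form_powerSum]
  by_cases hA : F = A
  · subst hA
    by_cases hB : G = B
    · subst hB
      simp [mul_comm]
    · simp [hB, Ne.symm hB]
  · simp [hA, Ne.symm hA]

theorem signedForm_isSelfDualPairing :
    hopfAlgebra.IsSelfDualPairing signedForm (signedTensorPairing fermionic signedForm) where
  mul_left := signedForm_mul
  mul_right f a b := by
    rw [signedForm, signedTensorPairing_comm, form_comm]
    exact signedForm_mul a b f
  one_left f := form_one _ (by simp [SuperPartition.z, SuperPartition.empty,
    SuperPartition.fermionicDegree]) f
  one_right f := (form_comm _ f 1).trans (form_one _ (by simp [SuperPartition.z,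
    SuperPartition.empty, SuperPartition.fermionicDegree]) f)
  antipode := form_diag _ _

end SuperSym

end

theorem mainTheorem1 :
    -- `Λ ⊗ Λ` is identified with functions of two alphabets, and the `p_Λ` form a basis of `Λ`
    Function.Injective SuperSym.evalTensor ∧
    LinearIndependent ℚ SuperPartition.powerSum ∧
    Submodule.span ℚ (Set.range SuperPartition.powerSum) = ⊤ ∧
    ∃ A : SuperHopfAlgebra SuperSym.fermionic,
      -- the coproduct is `f ↦ f(x, y; θ, φ)`
      (∀ (f : SuperSym) (N M : ℕ),
        SuperSym.evalTensor (A.comul f) N M = SuperSym.evalUnion f N M) ∧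
      -- the counit vanishes in positive degree
      (∀ k ≠ 0, ∀ f ∈ SuperSym.simpleDegree k, A.counit f = 0) ∧
      A.IsGradedConnected SuperSym.simpleDegree ∧
      A.IsCocommutative ∧
      -- self-duality with the signed twist
      (∃ B : SuperSym →ₗ[ℚ] SuperSym →ₗ[ℚ] ℚ,
        (∀ L M : SuperPartition, B L.powerSum M.powerSum =
          if L = M then (-1) ^ (L.fermionicDegree.choose 2) * L.z else 0) ∧
        B.Nondegenerate ∧
        A.IsSelfDualPairing B
          (SuperHopfAlgebra.signedTensorPairing SuperSym.fermionic B)) ∧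
      -- the same in terms of the form without the sign on the power sums
      (∃ B : SuperSym →ₗ[ℚ] SuperSym →ₗ[ℚ] ℚ,
        (∀ L M : SuperPartition, B L.powerSum M.powerSum = if L = M then L.z else 0) ∧
        B.Nondegenerate ∧
        A.IsSelfDualPairing B (SuperHopfAlgebra.plainTensorPairing B) ∧
        ∀ f g h : SuperSym,
          SuperHopfAlgebra.signedTensorPairing SuperSym.fermionic B (A.comul f) (g ⊗ₜ[ℚ] h) =
            B f (h * g)) :=
  ⟨SuperSym.injective_evalTensor, SuperPartition.linearIndependent_powerSum,
    SuperSym.span_powerSum, SuperSym.hopfAlgebra,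
    fun f N M => congrFun (congrFun (SuperSym.evalTensor_comul f) N) M,
    SuperSym.counit_of_mem_simpleDegree, SuperSym.isGradedConnected_hopfAlgebra,
    SuperSym.isCocommutative_hopfAlgebra,
    ⟨SuperSym.signedForm, SuperSym.signedForm_powerSum,
      SuperSym.nondegenerate_form fun L => mul_ne_zero (pow_ne_zero _ (by norm_num)) L.z_ne_zero,
      SuperSym.signedForm_isSelfDualPairing⟩,
    ⟨SuperSym.hallForm, SuperSym.hallForm_powerSum,
      SuperSym.nondegenerate_form SuperPartition.z_ne_zero,
      SuperSym.hallForm_isSelfDualPairing, SuperSym.signedTensorPairing_hallForm⟩⟩
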